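/- Let $\mathbb{D}$ be the open unit disk of $\mathbb{C}$ and let $H^2$ be the Hardy space of the functions $f(z)=\sum_{n\ge 0} b_n z^n$ on $\mathbb{D}$ with $\|f\|^2=\sum_{n\ge 0}|b_n|^2<\infty$. For a bounded operator $T$ on $H^2$ and $n\ge 1$, let $a_n(T)=\inf\{\|T-R\| : \operatorname{rank} R<n\}$ be its $n$-th approximation number, and put $\beta(T)=\lim_{n\to\infty}[a_n(T)]^{1/n}$ when this limit exists. Let $g(z,w)=\log\left|\frac{1-\overline{w}z}{z-w}\right|$ be the Green function of $\mathbb{D}$ (with $g(z,z)=+\infty$). For $E\subseteq\mathbb{D}$ let $V(E)\in[0,\infty]$ be the infimum of $\iint_{\mathbb{D}\times\mathbb{D}} g(z,w)\,d\mu(z)\,d\mu(w)$ over all Borel probability measures $\mu$ supported by a compact subset of $E$ (with $\inf\emptyset=+\infty$), and let $\operatorname{Cap}(E)=1/V(E)\in[0,\infty]$ be the Green capacity of $E$. Let $a,b,c,d\in\mathbb{C}$ and let $\varphi(z)=\dfrac{az+b}{cz+d}$. (1) If $ad-bc\neq 0$, then $\varphi$ maps $\mathbb{D}$ into $\mathbb{D}$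 (that is, $cz+d\ne 0$ and $|\varphi(z)|<1$ for every $z\in\mathbb{D}$) if and only if $$|a|^2+|b|^2+2\,|\overline{a}b-\overline{c}d|\le |c|^2+|d|^2\quad\text{and}\quad |c|\le |d|.$$ (2) Suppose that $\varphi$ maps $\mathbb{D}$ into $\mathbb{D}$, in the sense that $cz+d\neq 0$ and $|\varphi(z)|<1$ for every $z\in\mathbb{D}$ (the case $ad-bc=0$ of a constant $\varphi$ is allowed). Let $K$ be the closure of $\varphi(\mathbb{D})$ in $\mathbb{D}$. Then $C_\varphi\colon f\mapsto f\circ\varphi$ is a bounded operator on $H^2$, the limit $\beta(C_\varphi)=\lim_{n\to\infty}[a_n(C_\varphi)]^{1/n}$ exists, and $$\beta(C_\varphi)=\exp\left[-\frac{1}{\operatorname{Cap}(K)}\right],$$ where the right-hand side is $0$ if $\operatorname{Cap}(K)=0$ and $1$ if $\operatorname{Cap}(K)=\infty$. -/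

import Mathlib

open scoped ENNReal Topology ComplexConjugate Complex.UnitDisc

noncomputable section

/-! ### The Hardy space of the unit disc -/

/-- The functions `f` on the unit disc of the form `f z = ∑ bₙ zⁿ` with `∑ |bₙ|² < ∞`. -/
def hardySubmodule : Submodule ℂ (𝔻 → ℂ) where
  carrier := {f | ∃ b : lp (fun _ : ℕ => ℂ) 2, ∀ z : 𝔻, HasSum (fun n => b n * (z : ℂ) ^ n) (f z)}
  zero_mem' := ⟨0, fun z => by simp⟩
  add_mem' := by
    rintro f g ⟨b, hb⟩ ⟨c, hc⟩
    exact ⟨b + c, fun z => by simpa [add_mul] using (hb z).add (hc z)⟩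
  smul_mem' := by
    rintro t f ⟨b, hb⟩
    exact ⟨t • b, fun z => by simpa [mul_assoc] using (hb z).mul_left t⟩

/-- The Hardy space `H²` of the unit disc, as a type of its own: it carries the Hardy norm below,
not the topology of pointwise convergence. -/
def HardySpace : Type := hardySubmodule

instance instAddCommGroupHardySpace : AddCommGroup HardySpace :=
  inferInstanceAs (AddCommGroup hardySubmodule)

instance instModuleHardySpace : Module ℂ HardySpace :=
  inferInstanceAs (Module ℂ hardySubmodule)

instance instCoeFunHardySpace : CoeFun HardySpace (fun _ => 𝔻 → ℂ) := ⟨fun f => f.1⟩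

@[simp] theorem HardySpace.add_apply (f g : HardySpace) (z : 𝔻) : (f + g) z = f z + g z := rfl

@[simp] theorem HardySpace.smul_apply (t : ℂ) (f : HardySpace) (z : 𝔻) : (t • f) z = t * f z := rfl

@[ext] theorem HardySpace.ext {f g : HardySpace} (h : ∀ z, f z = g z) : f = g :=
  Subtype.ext (funext h)

/-- The sequence of Taylor coefficients at `0` of an element of the Hardy space. -/
def hardyCoeff (f : HardySpace) : lp (fun _ : ℕ => ℂ) 2 := f.2.choose

theorem hasSum_hardyCoeff (f : HardySpace) (z : 𝔻) :
    HasSum (fun n => hardyCoeff f n * (z : ℂ) ^ n) (f z) := f.2.choose_spec z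

theorem hardyCoeff_unique {b c : lp (fun _ : ℕ => ℂ) 2} {f : 𝔻 → ℂ}
    (hb : ∀ z : 𝔻, HasSum (fun n => b n * (z : ℂ) ^ n) (f z))
    (hc : ∀ z : 𝔻, HasSum (fun n => c n * (z : ℂ) ^ n) (f z)) : b = c := by
  classical
  let F : ℂ → ℂ := fun z => if h : ‖z‖ < 1 then f (Complex.UnitDisc.mk z h) else 0
  have key : ∀ d : lp (fun _ : ℕ => ℂ) 2, (∀ z : 𝔻, HasSum (fun n => d n * (z : ℂ) ^ n) (f z)) →
      HasFPowerSeriesAt F (FormalMultilinearSeries.ofScalars ℂ (fun n => d n)) 0 := by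
    intro d hd
    rw [hasFPowerSeriesAt_iff]
    filter_upwards [Metric.ball_mem_nhds (0 : ℂ) one_pos] with z hz
    have hz' : ‖z‖ < 1 := by simpa using hz
    have h := hd (Complex.UnitDisc.mk z hz')
    simpa [F, hz', FormalMultilinearSeries.coeff_ofScalars, mul_comm] using h
  have h := (key b hb).eq_formalMultilinearSeries (key c hc)
  ext n
  have h2 := congrArg (fun p => FormalMultilinearSeries.coeff p n) h
  simpa [FormalMultilinearSeries.coeff_ofScalars] using h2

/-- The Hardy space is identified with `ℓ²` through the Taylor coefficients. -/
def hardyEquiv : HardySpace ≃ₗ[ℂ] lp (fun _ : ℕ => ℂ) 2 :=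
  LinearEquiv.ofBijective
    { toFun := hardyCoeff
      map_add' := fun f g => hardyCoeff_unique (hasSum_hardyCoeff (f + g)) fun z => by
        simpa [add_mul] using (hasSum_hardyCoeff f z).add (hasSum_hardyCoeff g z)
      map_smul' := fun t f => hardyCoeff_unique (hasSum_hardyCoeff (t • f)) fun z => by
        simpa [mul_assoc] using (hasSum_hardyCoeff f z).mul_left t }
    ⟨fun f g h => by
      have h' : hardyCoeff f = hardyCoeff g := h
      refine HardySpace.ext fun z => ?_
      have hf := hasSum_hardyCoeff f z
      rw [h'] at hf
      exact hf.unique (hasSum_hardyCoeff g z),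
    fun b => by
      have hs : ∀ z : 𝔻, Summable (fun n => b n * (z : ℂ) ^ n) := fun z => by
        refine Summable.of_norm_bounded (g := fun n => ‖b‖ * ‖(z : ℂ)‖ ^ n)
          ((summable_geometric_of_lt_one (norm_nonneg _) z.norm_lt_one).mul_left _) fun n => ?_
        rw [norm_mul, norm_pow]
        gcongr
        exact lp.norm_apply_le_norm (by norm_num) b n
      refine ⟨⟨fun z => ∑' n, b n * (z : ℂ) ^ n, b, fun z => (hs z).hasSum⟩, ?_⟩
      exact hardyCoeff_unique (hasSum_hardyCoeff _) fun z => (hs z).hasSum⟩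

/-- The Hardy norm, `‖f‖² = ∑ |bₙ|²` for `f z = ∑ bₙ zⁿ`. -/
instance instNormedAddCommGroupHardySpace : NormedAddCommGroup HardySpace :=
  NormedAddCommGroup.induced HardySpace (lp (fun _ : ℕ => ℂ) 2) hardyEquiv hardyEquiv.injective

/-- The Hardy inner product, `⟪f, g⟫ = ∑ conj bₙ * cₙ` for `f z = ∑ bₙ zⁿ`, `g z = ∑ cₙ zⁿ`. -/
instance instInnerProductSpaceHardySpace : InnerProductSpace ℂ HardySpace :=
  InnerProductSpace.induced hardyEquiv

instance instCompleteSpaceHardySpace : CompleteSpace HardySpace :=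
  (LinearIsometryEquiv.mk hardyEquiv fun _ => rfl : HardySpace ≃ₗᵢ[ℂ] lp (fun _ : ℕ => ℂ) 2)
    |>.toIsometryEquiv.completeSpace

/-- `T` is the composition operator `f ↦ f ∘ φ` on the Hardy space. -/
def IsCompositionOperator (φ : 𝔻 → 𝔻) (T : HardySpace →L[ℂ] HardySpace) : Prop :=
  ∀ (f : HardySpace) (z : 𝔻), T f z = f (φ z)

/-! ### Approximation numbers -/

/-- The `n`-th approximation number, `aₙ(T) = inf {‖T - R‖ ; rank R < n}` (for `n ≥ 1`). -/
def approxNumber {X Y : Type*} [NormedAddCommGroup X] [NormedSpace ℂ X]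
    [NormedAddCommGroup Y] [NormedSpace ℂ Y] (T : X →L[ℂ] Y) (n : ℕ) : ℝ :=
  sInf {t : ℝ | ∃ R : X →L[ℂ] Y, LinearMap.rank (R : X →ₗ[ℂ] Y) < (n : Cardinal) ∧ t = ‖T - R‖}

/-! ### Green capacity in the unit disc -/

instance instMeasurableSpaceUnitDisc : MeasurableSpace 𝔻 := borel 𝔻

instance instBorelSpaceUnitDisc : BorelSpace 𝔻 := ⟨rfl⟩

/-- The Green function of the unit disc, `log |(1 - conj w * z) / (z - w)|`, infinite on the
diagonal. -/
def greenFunction (z w : 𝔻) : ℝ≥0∞ :=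
  open Classical in
  if z = w then ∞
  else ENNReal.ofReal (Real.log ‖(1 - conj (w : ℂ) * (z : ℂ)) / ((z : ℂ) - (w : ℂ))‖)

/-- The Green potential of a measure. -/
def greenPotential (μ : MeasureTheory.Measure 𝔻) (z : 𝔻) : ℝ≥0∞ := ∫⁻ w, greenFunction z w ∂μ

/-- The Green energy of a measure. -/
def greenEnergy (μ : MeasureTheory.Measure 𝔻) : ℝ≥0∞ := ∫⁻ z, greenPotential μ z ∂μ

/-- The infimum `V(E)` of the energies of the probability measures that are carried by a compact
subset of `E`. -/
def greenV (E : Set 𝔻) : ℝ≥0∞ :=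
  sInf {t | ∃ μ : MeasureTheory.Measure 𝔻, MeasureTheory.IsProbabilityMeasure μ ∧
    (∃ L : Set 𝔻, L ⊆ E ∧ IsCompact L ∧ μ Lᶜ = 0) ∧ t = greenEnergy μ}

/-- The Green capacity `1 / V(E)`, with `1 / ∞ = 0` and `1 / 0 = ∞`. -/
def greenCapacity (E : Set 𝔻) : ℝ≥0∞ := 1 / greenV E

/-- `exp (-1 / c)` for `c` in `[0, ∞]`, equal to `0` at `c = 0` and to `1` at `c = ∞`. -/
def expNegInv (c : ℝ≥0∞) : ℝ := (EReal.exp (-((1 / c : ℝ≥0∞) : EReal))).toReal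

end

/-! ### Evaluation in the Hardy space -/

/-! Write `A = |c|² - |a|²`, `D = |d|² - |b|²`, `q = conj a * b - conj c * d`. Then `|cz+d|² -
|az+b|² = A|z|² + D - 2 Re (conj z * q)`, and the best direction of `z` on the unit circle turns
positivity into `2|q| ≤ A + D`. For the converse, `|q|² = A D + |ad - bc|²` and `|c| ≤ |d|` give `A
< D`, so the difference is at least `(1 - ρ)(D - Aρ) > 0` with `ρ = |z|`.

For the approximation numbers, a nonconstant `φ` has no pole on the closed disc, so it is `p + s *
m` with `m` an automorphism and `‖p‖ + ‖s‖ ≤ 1` (`exists_affine_moebius`). Composition with an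
automorphism is bounded with bounded inverse, so it changes approximation numbers only by constant
factors, and it preserves the Green function. Everything is thus compared with the dilation `z ↦ r
z`, which is diagonal with entries `r ^ k`, so that the n-th roots tend to `r`. On the potential
side, a disc of radius `r` centred at `0` has `V = -log r`: the uniform measure on circles gives one
inequality, and the other follows from a kernel expansion with nonnegative coefficients.

If `‖p‖ + ‖s‖ < 1`, the image is a hyperbolic disc and `φ` is a dilation up to automorphisms on both
sides. If `‖p‖ + ‖s‖ = 1`, the image is a disc tangent to the unit circle; it contains hyperbolic
discs of every radius `t < 1`, so both sides equal `1`. Both cases go through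
`tendsto_approxNumber_of_factorization`. A constant `φ` gives rank one and a singleton of infinite
energy, so both sides are `0`.

Boundedness is obtained by hand: a Schur test for affine maps, and the reproducing kernels for
automorphisms. -/

theorem HardySpace.norm_eq (f : HardySpace) : ‖f‖ = ‖hardyCoeff f‖ := rfl

theorem HardySpace.inner_eq (f g : HardySpace) :
    inner ℂ f g = inner ℂ (hardyCoeff f) (hardyCoeff g) := rfl

theorem memℓp_conj_pow (w : 𝔻) : Memℓp (fun n : ℕ => conj (w : ℂ) ^ n) 2 := by
  rw [memℓp_gen_iff (by norm_num)]
  have h : ‖(w : ℂ)‖ ^ 2 < 1 := w.sq_norm_lt_one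
  refine (summable_geometric_of_lt_one (sq_nonneg _) h).congr fun n => ?_
  simp only [norm_pow, RCLike.norm_conj, ENNReal.toReal_ofNat, Real.rpow_ofNat]
  ring

/-- The reproducing kernel of the Hardy space. -/
noncomputable def hardyKernel (w : 𝔻) : HardySpace :=
  hardyEquiv.symm ⟨fun n => conj (w : ℂ) ^ n, memℓp_conj_pow w⟩

theorem hardyCoeff_hardyKernel (w : 𝔻) (n : ℕ) :
    hardyCoeff (hardyKernel w) n = conj (w : ℂ) ^ n := by
  have : hardyEquiv (hardyKernel w) = _ := hardyEquiv.apply_symm_apply _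
  exact congrArg (fun b : lp (fun _ : ℕ => ℂ) 2 => b n) this

theorem inner_hardyKernel (w : 𝔻) (f : HardySpace) : inner ℂ (hardyKernel w) f = f w := by
  have h := lp.hasSum_inner (𝕜 := ℂ) (hardyCoeff (hardyKernel w)) (hardyCoeff f)
  refine h.unique ?_
  convert! hasSum_hardyCoeff f w using 2 with n
  simp [hardyCoeff_hardyKernel]

theorem one_sub_conj_mul_ne_zero (z w : 𝔻) : 1 - conj (w : ℂ) * (z : ℂ) ≠ 0 := by
  intro h
  have h1 : ‖conj (w : ℂ) * (z : ℂ)‖ = 1 := by rw [← sub_eq_zero.1 h]; simp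
  rw [norm_mul, RCLike.norm_conj] at h1
  nlinarith [norm_nonneg (w : ℂ), norm_nonneg (z : ℂ), w.norm_lt_one, z.norm_lt_one]

theorem hardyKernel_apply (w z : 𝔻) : hardyKernel w z = (1 - conj (w : ℂ) * (z : ℂ))⁻¹ := by
  refine (hasSum_hardyCoeff (hardyKernel w) z).unique ?_
  simp only [hardyCoeff_hardyKernel, ← mul_pow]
  refine hasSum_geometric_of_norm_lt_one ?_
  rw [norm_mul, RCLike.norm_conj]
  nlinarith [norm_nonneg (w : ℂ), norm_nonneg (z : ℂ), w.norm_lt_one, z.norm_lt_one]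

theorem denseRange_linearCombination_hardyKernel :
    DenseRange (Finsupp.linearCombination ℂ hardyKernel) := by
  have h : (LinearMap.range (Finsupp.linearCombination ℂ hardyKernel)).topologicalClosure = ⊤ := by
    rw [Submodule.topologicalClosure_eq_top_iff, Submodule.eq_bot_iff]
    intro f hf
    refine HardySpace.ext fun z => ?_
    rw [← inner_hardyKernel]
    exact (Submodule.mem_orthogonal _ _).1 hf _ ⟨Finsupp.single z 1, by simp⟩
  exact (Submodule.dense_iff_topologicalClosure_eq_top).2 h

/-- A weight that transports the reproducing kernel along `τ` gives a bounded weighted composition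
operator. -/
theorem exists_weightedComposition {τ : 𝔻 → 𝔻} {g : 𝔻 → ℂ}
    (h : ∀ z w : 𝔻, g z * conj (g w) * (1 - conj (w : ℂ) * (z : ℂ)) =
      1 - conj (τ w : ℂ) * (τ z : ℂ)) :
    ∃ V : HardySpace →L[ℂ] HardySpace, ∀ f z, V f z = g z * f (τ z) := by
  have hk : ∀ z w : 𝔻, inner ℂ (conj (g z) • hardyKernel (τ z)) (conj (g w) • hardyKernel (τ w)) =
      inner ℂ (hardyKernel z) (hardyKernel w) := by
    intro z w
    rw [inner_smul_left, inner_smul_right, inner_hardyKernel, inner_hardyKernel,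
      hardyKernel_apply, hardyKernel_apply, ← h, mul_inv, ← mul_assoc]
    have hne : g z * conj (g w) ≠ 0 := by
      intro h0
      have := h z w
      rw [h0, zero_mul] at this
      exact one_sub_conj_mul_ne_zero _ _ this.symm
    rw [Complex.conj_conj, ← mul_assoc, mul_inv_cancel₀ hne, one_mul]
  set e := Finsupp.linearCombination ℂ hardyKernel with he
  set T := Finsupp.linearCombination ℂ (fun w => conj (g w) • hardyKernel (τ w)) with hT
  -- The two families have the same Gram matrix, so `hardyKernel z ↦ conj (g z) • hardyKernel (τ z)`
  -- extends to an isometry; its adjoint is the weighted composition operator.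
  have hnorm : ∀ c, ‖T c‖ ≤ 1 * ‖e c‖ := by
    intro c
    have h2 : inner ℂ (T c) (T c) = inner ℂ (e c) (e c) := by
      rw [hT, he, Finsupp.linearCombination_apply, Finsupp.linearCombination_apply, Finsupp.sum,
        Finsupp.sum]
      simp only [sum_inner, inner_sum, inner_smul_left _ _ (c _), inner_smul_right _ _ (c _), hk]
    rw [inner_self_eq_norm_sq_to_K, inner_self_eq_norm_sq_to_K] at h2
    have h3 : ‖T c‖ ^ 2 = ‖e c‖ ^ 2 := by exact_mod_cast h2
    rw [one_mul]
    exact ((sq_eq_sq₀ (norm_nonneg _) (norm_nonneg _)).1 h3).le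
  refine ⟨ContinuousLinearMap.adjoint (T.extendOfNorm e), fun f z => ?_⟩
  have h4 : T.extendOfNorm e (hardyKernel z) = conj (g z) • hardyKernel (τ z) := by
    have := LinearMap.extendOfNorm_eq denseRange_linearCombination_hardyKernel ⟨1, hnorm⟩
      (Finsupp.single z 1)
    simpa [he, hT] using this
  rw [← inner_hardyKernel, ContinuousLinearMap.adjoint_inner_right, h4, inner_smul_left,
    inner_hardyKernel, Complex.conj_conj]

/-! ### Matrix operators -/

/-- Weighted Cauchy–Schwarz, from `2 x i x j ≤ x i ² + x j ²` summed against the symmetric weight `a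
i * a j`. In `ℝ≥0∞` no summability has to be assumed. -/
theorem ENNReal.sq_tsum_mul_le {ι : Type*} (a x : ι → ℝ≥0∞) :
    (∑' i, a i * x i) ^ 2 ≤ (∑' i, a i) * ∑' i, a i * x i ^ 2 := by
  have key : ∀ s t : ℝ≥0∞, 2 * (s * t) ≤ s ^ 2 + t ^ 2 := by
    intro s t
    rcases eq_or_ne s ∞ with rfl | hs
    · simp
    rcases eq_or_ne t ∞ with rfl | ht
    · simp
    lift s to NNReal using hs
    lift t to NNReal using ht
    exact_mod_cast (by simpa [mul_assoc] using two_mul_le_add_sq s t)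
  have h1 : (∑' i, a i * x i) ^ 2 = ∑' i, ∑' j, a i * a j * (x i * x j) := by
    rw [sq, ← ENNReal.tsum_mul_right]
    refine tsum_congr fun i => ?_
    rw [← ENNReal.tsum_mul_left]
    exact tsum_congr fun j => by ring
  have h2 : (∑' i, a i) * ∑' i, a i * x i ^ 2 = ∑' i, ∑' j, a i * a j * x j ^ 2 := by
    rw [← ENNReal.tsum_mul_right]
    refine tsum_congr fun i => ?_
    rw [← ENNReal.tsum_mul_left]
    exact tsum_congr fun j => by ring
  have h3 : (∑' i, a i) * ∑' i, a i * x i ^ 2 = ∑' i, ∑' j, a i * a j * x i ^ 2 := by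
    rw [h2, ENNReal.tsum_comm]
    exact tsum_congr fun i => tsum_congr fun j => by ring
  have h4 : 2 * (∑' i, a i * x i) ^ 2 ≤ 2 * ((∑' i, a i) * ∑' i, a i * x i ^ 2) := by
    rw [two_mul ((∑' i, a i) * _)]
    nth_rewrite 1 [h3]
    rw [h2, h1, ← ENNReal.tsum_add, ← ENNReal.tsum_mul_left]
    refine ENNReal.tsum_le_tsum fun i => ?_
    rw [← ENNReal.tsum_add, ← ENNReal.tsum_mul_left]
    refine ENNReal.tsum_le_tsum fun j => ?_
    calc 2 * (a i * a j * (x i * x j)) = a i * a j * (2 * (x i * x j)) := by ring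
      _ ≤ a i * a j * (x i ^ 2 + x j ^ 2) := by gcongr; exact key _ _
      _ = _ := by ring
  exact (ENNReal.mul_le_mul_iff_right (by norm_num) (by norm_num)).1 h4

theorem lp.tsum_enorm_sq (b : lp (fun _ : ℕ => ℂ) 2) :
    ∑' n, ‖b n‖ₑ ^ 2 = ENNReal.ofReal (‖b‖ ^ 2) := by
  have h := lp.hasSum_norm (p := 2) (by norm_num) b
  simp only [ENNReal.toReal_ofNat, Real.rpow_ofNat] at h
  rw [← h.tsum_eq, ENNReal.ofReal_tsum_of_nonneg (fun _ => by positivity) h.summable]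
  exact tsum_congr fun n => by rw [← ofReal_norm, ENNReal.ofReal_pow (norm_nonneg _)]

theorem memℓp_two_of_tsum_enorm_sq {b : ℕ → ℂ} (h : ∑' n, ‖b n‖ₑ ^ 2 ≠ ∞) :
    Memℓp (E := fun _ : ℕ => ℂ) b 2 := by
  rw [memℓp_gen_iff (by norm_num)]
  have := ENNReal.summable_toReal h
  simpa using this

/-- The Schur test, for an operator given by a matrix in the monomial basis. -/
theorem exists_matrixOperator {A : ℕ → ℕ → ℂ} {R S : ℝ≥0∞} (hR : R ≠ ∞) (hS : S ≠ ∞)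
    (hrow : ∀ k, ∑' n, ‖A k n‖ₑ ≤ R) (hcol : ∀ n, ∑' k, ‖A k n‖ₑ ≤ S) :
    ∃ T : HardySpace →L[ℂ] HardySpace,
      ∀ f z, T f z = ∑' n, hardyCoeff f n * ∑' k, A k n * (z : ℂ) ^ k := by
  have hle : ∀ (b : lp (fun _ : ℕ => ℂ) 2) n, ‖b n‖ₑ ≤ ‖b‖ₑ := fun b n => by
    rw [← ofReal_norm, ← ofReal_norm]
    exact ENNReal.ofReal_le_ofReal (lp.norm_apply_le_norm (by norm_num) b n)
  have hrow' : ∀ (b : lp (fun _ : ℕ => ℂ) 2) k, ∑' n, ‖A k n * b n‖ₑ ≤ R * ‖b‖ₑ := fun b k => by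
    calc ∑' n, ‖A k n * b n‖ₑ ≤ ∑' n, ‖A k n‖ₑ * ‖b‖ₑ :=
          ENNReal.tsum_le_tsum fun n => by rw [enorm_mul]; gcongr; exact hle b n
      _ ≤ R * ‖b‖ₑ := by rw [ENNReal.tsum_mul_right]; gcongr; exact hrow k
  have hfin : ∀ b : lp (fun _ : ℕ => ℂ) 2, R * ‖b‖ₑ ≠ ∞ := fun b =>
    ENNReal.mul_ne_top hR enorm_ne_top
  have hsum : ∀ (b : lp (fun _ : ℕ => ℂ) 2) k, Summable fun n => A k n * b n := fun b k =>
    Summable.of_enorm ((hrow' b k).trans_lt (hfin b).lt_top).ne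
  have hsq : ∀ b : lp (fun _ : ℕ => ℂ) 2,
      ∑' k, ‖∑' n, A k n * b n‖ₑ ^ 2 ≤ R * S * ENNReal.ofReal (‖b‖ ^ 2) := fun b => by
    calc ∑' k, ‖∑' n, A k n * b n‖ₑ ^ 2 ≤ ∑' k, R * ∑' n, ‖A k n‖ₑ * ‖b n‖ₑ ^ 2 := by
          refine ENNReal.tsum_le_tsum fun k => ?_
          calc ‖∑' n, A k n * b n‖ₑ ^ 2 ≤ (∑' n, ‖A k n‖ₑ * ‖b n‖ₑ) ^ 2 := by
                gcongr
                simp only [← enorm_mul]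
                exact enorm_tsum_le_tsum_enorm
            _ ≤ (∑' n, ‖A k n‖ₑ) * ∑' n, ‖A k n‖ₑ * ‖b n‖ₑ ^ 2 := ENNReal.sq_tsum_mul_le _ _
            _ ≤ _ := by gcongr; exact hrow k
      _ = R * ∑' n, ‖b n‖ₑ ^ 2 * ∑' k, ‖A k n‖ₑ := by
          rw [ENNReal.tsum_mul_left, ENNReal.tsum_comm]
          congr 1
          refine tsum_congr fun n => ?_
          rw [← ENNReal.tsum_mul_left]
          exact tsum_congr fun k => mul_comm _ _
      _ ≤ R * ∑' n, ‖b n‖ₑ ^ 2 * S := by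
          gcongr with n
          exact hcol n
      _ = _ := by rw [ENNReal.tsum_mul_right, lp.tsum_enorm_sq]; ring
  have hfin2 : ∀ b : lp (fun _ : ℕ => ℂ) 2, R * S * ENNReal.ofReal (‖b‖ ^ 2) ≠ ∞ := fun b =>
    ENNReal.mul_ne_top (ENNReal.mul_ne_top hR hS) ENNReal.ofReal_ne_top
  let T₀ : lp (fun _ : ℕ => ℂ) 2 →ₗ[ℂ] lp (fun _ : ℕ => ℂ) 2 :=
    { toFun := fun b => ⟨fun k => ∑' n, A k n * b n,
        memℓp_two_of_tsum_enorm_sq ((hsq b).trans_lt (hfin2 b).lt_top).ne⟩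
      map_add' := fun b c => by
        ext k
        simp only [lp.coeFn_add, Pi.add_apply, mul_add]
        exact (hsum b k).tsum_add (hsum c k)
      map_smul' := fun t b => by
        ext k
        simp only [lp.coeFn_smul, Pi.smul_apply, smul_eq_mul, RingHom.id_apply, ← tsum_mul_left]
        exact tsum_congr fun n => by ring }
  have hT₀ : ∀ b, ‖T₀ b‖ ≤ Real.sqrt (R * S).toReal * ‖b‖ := fun b => by
    refine (sq_le_sq₀ (norm_nonneg _) (by positivity)).1 ?_
    rw [mul_pow, Real.sq_sqrt ENNReal.toReal_nonneg]
    have h1 := lp.tsum_enorm_sq (T₀ b)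
    have h2 := ENNReal.toReal_mono (hfin2 b) (h1.symm.le.trans (hsq b))
    rwa [ENNReal.toReal_ofReal (by positivity), ENNReal.toReal_mul,
      ENNReal.toReal_ofReal (by positivity)] at h2
  refine ⟨LinearMap.mkContinuous (hardyEquiv.symm.toLinearMap ∘ₗ T₀ ∘ₗ hardyEquiv.toLinearMap)
    (Real.sqrt (R * S).toReal) fun f => ?_, fun f z => ?_⟩
  · have : ‖hardyEquiv (hardyEquiv.symm (T₀ (hardyEquiv f)))‖ = ‖T₀ (hardyEquiv f)‖ := by
      rw [LinearEquiv.apply_symm_apply]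
    exact this.le.trans (hT₀ _)
  · set g : HardySpace := hardyEquiv.symm (T₀ (hardyEquiv f)) with hg
    have hgc : hardyCoeff g = T₀ (hardyCoeff f) := hardyEquiv.apply_symm_apply _
    have hgz := hasSum_hardyCoeff g z
    rw [hgc] at hgz
    change g z = _
    rw [← hgz.tsum_eq]
    have hz : ‖(z : ℂ)‖ₑ < 1 := by
      rw [← ofReal_norm]
      exact ENNReal.ofReal_lt_one.2 z.norm_lt_one
    -- The row sums are only bounded in `k`; the factor `‖z‖ ^ k` supplies the decay that justifies
    -- exchanging the sums.
    have hS2 : Summable (Function.uncurry fun k n => A k n * hardyCoeff f n * (z : ℂ) ^ k) := by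
      refine Summable.of_enorm (ne_of_lt ?_)
      rw [ENNReal.tsum_prod']
      calc ∑' k, ∑' n, ‖A k n * hardyCoeff f n * (z : ℂ) ^ k‖ₑ
          = ∑' k, (∑' n, ‖A k n * hardyCoeff f n‖ₑ) * ‖(z : ℂ)‖ₑ ^ k := by
            refine tsum_congr fun k => ?_
            rw [← ENNReal.tsum_mul_right]
            exact tsum_congr fun n => by rw [enorm_mul _ ((z : ℂ) ^ k), enorm_pow]
        _ ≤ ∑' k, (R * ‖hardyCoeff f‖ₑ) * ‖(z : ℂ)‖ₑ ^ k := by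
            gcongr with k
            exact hrow' _ k
        _ < ∞ := by
            rw [ENNReal.tsum_mul_left, ENNReal.tsum_geometric]
            refine ENNReal.mul_lt_top (hfin _).lt_top ?_
            exact ENNReal.inv_lt_top.2 (tsub_pos_of_lt hz)
    calc ∑' k, (∑' n, A k n * hardyCoeff f n) * (z : ℂ) ^ k
        = ∑' k, ∑' n, A k n * hardyCoeff f n * (z : ℂ) ^ k := by simp only [tsum_mul_right]
      _ = ∑' n, ∑' k, A k n * hardyCoeff f n * (z : ℂ) ^ k := hS2.tsum_comm.symm
      _ = _ := tsum_congr fun n => by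
          rw [← tsum_mul_left]
          exact tsum_congr fun k => by ring

/-! ### Bounded composition operators -/

theorem IsCompositionOperator.comp {φ ψ : 𝔻 → 𝔻} {S T : HardySpace →L[ℂ] HardySpace}
    (hS : IsCompositionOperator φ S) (hT : IsCompositionOperator ψ T) :
    IsCompositionOperator (ψ ∘ φ) (S ∘L T) := fun f z => by
  rw [ContinuousLinearMap.comp_apply, hS, hT]
  rfl

theorem IsCompositionOperator.unique {φ : 𝔻 → 𝔻} {S T : HardySpace →L[ℂ] HardySpace}
    (hS : IsCompositionOperator φ S) (hT : IsCompositionOperator φ T) : S = T := by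
  ext f z
  rw [hS, hT]

/-- Row sums of the matrix of composition with `p + s z`, whose `n`-th column is the expansion of
`(p + s z) ^ n`. The negative binomial series gives `‖s‖ ^ k / (1 - ‖p‖) ^ (k + 1)`, and `‖s‖ ≤ 1 -
‖p‖` makes this uniform in `k`. -/
theorem tsum_enorm_choose_mul_le {p s : ℂ} (hp : ‖p‖ < 1) (hps : ‖p‖ + ‖s‖ ≤ 1) (k : ℕ) :
    ∑' n : ℕ, ‖(n.choose k : ℂ) * p ^ (n - k) * s ^ k‖ₑ ≤ ENNReal.ofReal (1 - ‖p‖)⁻¹ := by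
  have h0 : 0 < 1 - ‖p‖ := by linarith
  have hs1 := summable_choose_mul_geometric_of_norm_lt_one (R := ℝ) k (r := ‖p‖) (by simpa)
  have hs2 := tsum_choose_mul_geometric_of_norm_lt_one (𝕜 := ℝ) k (r := ‖p‖) (by simpa)
  have e1 : ∑' n : ℕ, ‖(n.choose k : ℂ) * p ^ (n - k) * s ^ k‖ₑ =
      ∑' n : ℕ, ‖((n + k).choose k : ℂ) * p ^ n * s ^ k‖ₑ := by
    have h := Summable.sum_add_tsum_nat_add' (k := k)
      (f := fun n : ℕ => ‖(n.choose k : ℂ) * p ^ (n - k) * s ^ k‖ₑ) ENNReal.summable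
    rw [← h, Finset.sum_eq_zero, zero_add]
    · simp only [Nat.add_sub_cancel]
    · intro n hn
      rw [Nat.choose_eq_zero_of_lt (Finset.mem_range.1 hn)]
      simp
  have e2 : ∀ n : ℕ, ‖((n + k).choose k : ℂ) * p ^ n * s ^ k‖ₑ =
      ENNReal.ofReal (((n + k).choose k : ℝ) * ‖p‖ ^ n * ‖s‖ ^ k) := fun n => by
    rw [← ofReal_norm, norm_mul, norm_mul, norm_pow, norm_pow, Complex.norm_natCast]
  rw [e1, tsum_congr e2, ← ENNReal.ofReal_tsum_of_nonneg (fun n => by positivity)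
    (hs1.mul_right _), tsum_mul_right, hs2]
  refine ENNReal.ofReal_le_ofReal ?_
  have h1 : ‖s‖ ^ k ≤ (1 - ‖p‖) ^ k := by gcongr; linarith
  calc 1 / (1 - ‖p‖) ^ (k + 1) * ‖s‖ ^ k ≤ 1 / (1 - ‖p‖) ^ (k + 1) * (1 - ‖p‖) ^ k := by gcongr
    _ = _ := by rw [pow_succ]; field_simp

theorem tsum_enorm_choose_mul_col_le {p s : ℂ} (hps : ‖p‖ + ‖s‖ ≤ 1) (n : ℕ) :
    ∑' k : ℕ, ‖(n.choose k : ℂ) * p ^ (n - k) * s ^ k‖ₑ ≤ 1 := by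
  rw [tsum_eq_sum (s := Finset.range (n + 1))]
  · have e : ∀ k ∈ Finset.range (n + 1), ‖(n.choose k : ℂ) * p ^ (n - k) * s ^ k‖ₑ =
        ENNReal.ofReal (‖s‖ ^ k * ‖p‖ ^ (n - k) * (n.choose k : ℝ)) := fun k _ => by
      rw [← ofReal_norm, norm_mul, norm_mul, norm_pow, norm_pow, Complex.norm_natCast]
      congr 1
      ring
    rw [Finset.sum_congr rfl e, ← ENNReal.ofReal_sum_of_nonneg (fun k _ => by positivity),
      ← add_pow]
    refine ENNReal.ofReal_le_one.2 (pow_le_one₀ (by positivity) (by linarith))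
  · intro k hk
    rw [Nat.choose_eq_zero_of_lt (by simpa using hk)]
    simp

/-- Both Schur bounds survive when `‖p‖ + ‖s‖ = 1`, so images tangent to the unit circle are covered
too. -/
theorem exists_compositionOperator_affine {φ : 𝔻 → 𝔻} {p s : ℂ} (hp : ‖p‖ < 1)
    (hps : ‖p‖ + ‖s‖ ≤ 1) (hφ : ∀ z, (φ z : ℂ) = p + s * (z : ℂ)) :
    ∃ C, IsCompositionOperator φ C := by
  obtain ⟨T, hT⟩ := exists_matrixOperator (A := fun k n => (n.choose k : ℂ) * p ^ (n - k) * s ^ k)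
    ENNReal.ofReal_ne_top ENNReal.one_ne_top (tsum_enorm_choose_mul_le hp hps)
    (tsum_enorm_choose_mul_col_le hps)
  refine ⟨T, fun f z => ?_⟩
  rw [hT, ← (hasSum_hardyCoeff f (φ z)).tsum_eq]
  refine tsum_congr fun n => ?_
  rw [hφ, tsum_eq_sum (s := Finset.range (n + 1)), add_comm p, add_pow]
  · congr 1
    refine Finset.sum_congr rfl fun k _ => ?_
    rw [mul_pow]
    ring
  · intro k hk
    rw [Nat.choose_eq_zero_of_lt (by simpa using hk)]
    simp

/-- Used to remove the weight from the weighted composition operators attached to automorphisms. -/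
theorem exists_mul_one_add (e : ℂ) :
    ∃ M : HardySpace →L[ℂ] HardySpace, ∀ f z, M f z = (1 + e * (z : ℂ)) * f z := by
  let A : ℕ → ℕ → ℂ := fun k n => (if k = n then 1 else 0) + (if k = n + 1 then e else 0)
  have hA : ∀ k n, ‖A k n‖ₑ ≤ (if k = n then 1 else 0) + (if k = n + 1 then ‖e‖ₑ else 0) := by
    intro k n
    refine (enorm_add_le _ _).trans (add_le_add ?_ ?_) <;> split_ifs <;> simp
  have hrow : ∀ k, ∑' n, ‖A k n‖ₑ ≤ 1 + ‖e‖ₑ := fun k => by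
    refine (ENNReal.tsum_le_tsum (hA k)).trans ?_
    rw [ENNReal.tsum_add]
    gcongr
    · exact (tsum_ite_eq' k _).le
    · rcases k with _ | k
      · simp
      · simp only [Nat.add_right_cancel_iff]
        exact (tsum_ite_eq' k _).le
  have hcol : ∀ n, ∑' k, ‖A k n‖ₑ ≤ 1 + ‖e‖ₑ := fun n => by
    refine (ENNReal.tsum_le_tsum fun k => hA k n).trans ?_
    rw [ENNReal.tsum_add]
    gcongr
    · exact (tsum_ite_eq n _).le
    · exact (tsum_ite_eq (n + 1) _).le
  obtain ⟨M, hM⟩ := exists_matrixOperator (by simp) (by simp) hrow hcol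
  refine ⟨M, fun f z => ?_⟩
  rw [hM, ← (hasSum_hardyCoeff f z).tsum_eq, ← tsum_mul_left]
  refine tsum_congr fun n => ?_
  have : ∑' k, A k n * (z : ℂ) ^ k = (z : ℂ) ^ n + e * (z : ℂ) ^ (n + 1) := by
    have h : ∀ k, A k n * (z : ℂ) ^ k = (if k = n then (z : ℂ) ^ n else 0) +
        (if k = n + 1 then e * (z : ℂ) ^ (n + 1) else 0) := fun k => by
      simp only [A, add_mul, ite_mul, one_mul, zero_mul]
      congr 1 <;> refine ite_congr rfl (fun h => by rw [h]) fun _ => rfl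
    rw [tsum_congr h]
    exact ((hasSum_ite_eq n _).add (hasSum_ite_eq (n + 1) _)).tsum_eq
  rw [this]
  ring

/-! ### Automorphisms of the disc -/

theorem one_add_conj_mul_ne_zero (a z : 𝔻) : 1 + conj (a : ℂ) * (z : ℂ) ≠ 0 := by
  simpa using one_sub_conj_mul_ne_zero z (-a)

/-- The transformation law of the reproducing kernel under automorphisms. On the diagonal it shows
that the disc is mapped into itself; off the diagonal it yields the invariance of the Green function
and the boundedness of the composition operators. -/
theorem one_sub_conj_moebius_mul {u : ℂ} (hu : ‖u‖ = 1) (a z w : 𝔻) :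
    1 - conj (u * ((w : ℂ) + a) / (1 + conj (a : ℂ) * w)) *
        (u * ((z : ℂ) + a) / (1 + conj (a : ℂ) * z)) =
      (1 - conj (a : ℂ) * a) * (1 - conj (w : ℂ) * z) /
        ((1 + a * conj (w : ℂ)) * (1 + conj (a : ℂ) * z)) := by
  have h1 := one_add_conj_mul_ne_zero a z
  have h2 : 1 + (a : ℂ) * conj (w : ℂ) ≠ 0 := by
    intro h
    refine one_add_conj_mul_ne_zero a w ?_
    simpa using congrArg conj h
  have hu' : conj u * u = 1 := by rw [Complex.conj_mul', hu]; norm_num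
  simp only [map_div₀, map_mul, map_add, map_one, Complex.conj_conj]
  rw [div_mul_div_comm, eq_div_iff (mul_ne_zero h2 h1), sub_mul,
    div_mul_cancel₀ _ (mul_ne_zero h2 h1)]
  linear_combination (-(conj (w : ℂ) + conj (a : ℂ)) * ((z : ℂ) + a)) * hu'

theorem moebius_norm_lt_one {u : ℂ} (hu : ‖u‖ = 1) (a z : 𝔻) :
    ‖u * ((z : ℂ) + a) / (1 + conj (a : ℂ) * z)‖ < 1 := by
  have h := one_sub_conj_moebius_mul hu a z z
  set x := u * ((z : ℂ) + a) / (1 + conj (a : ℂ) * z)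
  have e : (1 + (a : ℂ) * conj (z : ℂ)) = conj (1 + conj (a : ℂ) * z) := by simp
  rw [e, Complex.conj_mul', Complex.conj_mul', Complex.conj_mul', Complex.conj_mul'] at h
  have h' : 1 - ‖x‖ ^ 2 = (1 - ‖(a : ℂ)‖ ^ 2) * (1 - ‖(z : ℂ)‖ ^ 2) /
    ‖1 + conj (a : ℂ) * (z : ℂ)‖ ^ 2 := by exact_mod_cast h
  have hpos : 0 < ‖1 + conj (a : ℂ) * (z : ℂ)‖ := norm_pos_iff.2 (one_add_conj_mul_ne_zero a z)
  have : 0 < 1 - ‖x‖ ^ 2 := by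
    rw [h']
    have := a.sq_norm_lt_one
    have := z.sq_norm_lt_one
    have h3 : 0 < 1 - ‖(a : ℂ)‖ ^ 2 := by linarith
    have h4 : 0 < 1 - ‖(z : ℂ)‖ ^ 2 := by linarith
    positivity
  exact (sq_lt_one_iff₀ (norm_nonneg _)).1 (by linarith)

/-- The map `z ↦ u (z + a) / (1 + conj a * z)` of the disc. -/
noncomputable def moebiusFun (u : Circle) (a z : 𝔻) : 𝔻 :=
  Complex.UnitDisc.mk ((u : ℂ) * ((z : ℂ) + a) / (1 + conj (a : ℂ) * z))
    (moebius_norm_lt_one u.norm_coe a z)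

theorem coe_moebiusFun (u : Circle) (a z : 𝔻) :
    (moebiusFun u a z : ℂ) = (u : ℂ) * ((z : ℂ) + a) / (1 + conj (a : ℂ) * z) := rfl

theorem continuous_moebiusFun (u : Circle) (a : 𝔻) : Continuous (moebiusFun u a) := by
  rw [Complex.UnitDisc.isEmbedding_coe.continuous_iff]
  have : ((↑) : 𝔻 → ℂ) ∘ moebiusFun u a =
      fun z : 𝔻 => (u : ℂ) * ((z : ℂ) + a) / (1 + conj (a : ℂ) * z) := rfl
  rw [this]
  have hc := Complex.UnitDisc.continuous_coe
  exact (by fun_prop : Continuous fun z : 𝔻 => (u : ℂ) * ((z : ℂ) + a)).div (by fun_prop)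
    (one_add_conj_mul_ne_zero a)

theorem moebiusFun_leftInverse (u : Circle) (a z : 𝔻) :
    moebiusFun u⁻¹ (-(u • a)) (moebiusFun u a z) = z := by
  apply Complex.UnitDisc.coe_injective
  have h1 := one_add_conj_mul_ne_zero a z
  have h2 := one_sub_conj_mul_ne_zero a a
  have hu : conj (u : ℂ) * u = 1 := by rw [Complex.conj_mul', u.norm_coe]; norm_num
  rw [coe_moebiusFun, coe_moebiusFun, Circle.coe_inv_eq_conj, Complex.UnitDisc.coe_neg,
    Complex.UnitDisc.coe_circle_smul, map_neg, map_mul]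
  have h4 : 1 + -(conj (u : ℂ) * conj (a : ℂ)) * (↑u * (↑z + ↑a) / (1 + conj (a : ℂ) * ↑z)) =
      (1 - conj (a : ℂ) * a) / (1 + conj (a : ℂ) * z) := by
    field_simp
    linear_combination (-conj (a : ℂ) * ((z : ℂ) + a)) * hu
  rw [h4, div_eq_iff (div_ne_zero h2 h1), mul_div_assoc', mul_add, mul_div_assoc', eq_div_iff h1,
    add_mul, div_mul_cancel₀ _ h1]
  linear_combination ((z : ℂ) - (a : ℂ) * z * conj (a : ℂ)) * hu

/-- The automorphism `z ↦ u (z + a) / (1 + conj a * z)` of the disc. -/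
noncomputable def moebius (u : Circle) (a : 𝔻) : 𝔻 ≃ₜ 𝔻 where
  toFun := moebiusFun u a
  invFun := moebiusFun u⁻¹ (-(u • a))
  left_inv := moebiusFun_leftInverse u a
  right_inv z := by
    have h : ∀ b : 𝔻, u • -b = -(u • b) := fun b => by
      apply Complex.UnitDisc.coe_injective
      simp
    have h2 : -(u⁻¹ • -(u • a)) = a := by
      rw [← h, inv_smul_smul, neg_neg]
    have := moebiusFun_leftInverse u⁻¹ (-(u • a)) z
    rwa [h2, inv_inv] at this
  continuous_toFun := continuous_moebiusFun _ _
  continuous_invFun := continuous_moebiusFun _ _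

theorem coe_moebius (u : Circle) (a z : 𝔻) :
    (moebius u a z : ℂ) = (u : ℂ) * ((z : ℂ) + a) / (1 + conj (a : ℂ) * z) := rfl

theorem moebius_symm (u : Circle) (a : 𝔻) : (moebius u a).symm = moebius u⁻¹ (-(u • a)) := by
  ext z
  rfl

theorem greenFunction_moebius (u : Circle) (a z w : 𝔻) :
    greenFunction (moebius u a z) (moebius u a w) = greenFunction z w := by
  unfold greenFunction
  rw [(moebius u a).injective.eq_iff]
  split_ifs with h
  · rfl
  congr 2
  have h1 := one_add_conj_mul_ne_zero a z
  have h2 := one_add_conj_mul_ne_zero a w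
  have h2' : 1 + (a : ℂ) * conj (w : ℂ) ≠ 0 := by
    intro h
    exact h2 (by simpa using congrArg conj h)
  have h3 := one_sub_conj_mul_ne_zero a a
  have hzw : (z : ℂ) - w ≠ 0 := by rwa [sub_ne_zero, Ne, Complex.UnitDisc.coe_inj]
  have e1 : (moebius u a z : ℂ) - moebius u a w =
      u * ((1 - conj (a : ℂ) * a) * (z - w)) /
        ((1 + conj (a : ℂ) * z) * (1 + conj (a : ℂ) * w)) := by
    rw [coe_moebius, coe_moebius, div_sub_div _ _ h1 h2]
    congr 1
    ring
  have e2 : 1 - conj (moebius u a w : ℂ) * moebius u a z = _ :=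
    one_sub_conj_moebius_mul u.norm_coe a z w
  rw [e1, e2]
  simp only [norm_div, norm_mul, Circle.norm_coe]
  have e3 : ‖1 + (a : ℂ) * conj (w : ℂ)‖ = ‖1 + conj (a : ℂ) * w‖ := by
    rw [← RCLike.norm_conj]
    simp
  rw [e3]
  have := norm_ne_zero_iff.2 h1
  have := norm_ne_zero_iff.2 h2
  have := norm_ne_zero_iff.2 h3
  have := norm_ne_zero_iff.2 hzw
  field_simp

/-- With the weight `t / (1 + conj a * z)`, `t = √(1 - |a|²)`, the kernel law is exactly the
hypothesis of `exists_weightedComposition`; multiplying by `t⁻¹ (1 + conj a * z)` cancels the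
weight. -/
theorem exists_compositionOperator_moebius (u : Circle) (a : 𝔻) :
    ∃ C, IsCompositionOperator (moebius u a) C := by
  have ha : 0 < 1 - ‖(a : ℂ)‖ ^ 2 := by linarith [a.sq_norm_lt_one]
  set t : ℂ := ((Real.sqrt (1 - ‖(a : ℂ)‖ ^ 2) : ℝ) : ℂ) with ht
  have ht0 : t ≠ 0 := by
    rw [ht]
    exact_mod_cast (Real.sqrt_pos.2 ha).ne'
  have htt : t * t = 1 - conj (a : ℂ) * a := by
    rw [ht, Complex.conj_mul']
    exact_mod_cast Real.mul_self_sqrt ha.le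
  obtain ⟨V, hV⟩ := exists_weightedComposition (τ := moebius u a)
    (g := fun z => t / (1 + conj (a : ℂ) * z)) fun z w => by
      have h1 := one_add_conj_mul_ne_zero a z
      have h2 : 1 + (a : ℂ) * conj (w : ℂ) ≠ 0 := by
        intro h
        exact one_add_conj_mul_ne_zero a w (by simpa using congrArg conj h)
      rw [coe_moebius, coe_moebius, one_sub_conj_moebius_mul u.norm_coe, ← htt]
      simp only [map_div₀, map_mul, map_add, map_one, Complex.conj_conj]
      have : conj t = t := Complex.conj_ofReal _
      rw [this]
      field_simp
  obtain ⟨M, hM⟩ := exists_mul_one_add (conj (a : ℂ))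
  refine ⟨t⁻¹ • (M ∘L V), fun f z => ?_⟩
  have h1 := one_add_conj_mul_ne_zero a z
  change t⁻¹ * M (V f) z = _
  rw [hM, hV]
  field_simp

/-! ### Approximation numbers -/

section approxNumber

variable {X Y : Type*} [NormedAddCommGroup X] [NormedSpace ℂ X]
  [NormedAddCommGroup Y] [NormedSpace ℂ Y]

theorem approxNumber_le (T : X →L[ℂ] Y) {n : ℕ} {R : X →L[ℂ] Y}
    (hR : LinearMap.rank (R : X →ₗ[ℂ] Y) < (n : Cardinal)) : approxNumber T n ≤ ‖T - R‖ :=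
  csInf_le ⟨0, by rintro _ ⟨S, -, rfl⟩; exact norm_nonneg _⟩ ⟨R, hR, rfl⟩

theorem approxNumber_nonneg (T : X →L[ℂ] Y) (n : ℕ) : 0 ≤ approxNumber T n :=
  Real.sInf_nonneg (by rintro _ ⟨S, -, rfl⟩; exact norm_nonneg _)

theorem le_approxNumber (T : X →L[ℂ] Y) {n : ℕ} (hn : n ≠ 0) {c : ℝ}
    (h : ∀ R : X →L[ℂ] Y, LinearMap.rank (R : X →ₗ[ℂ] Y) < (n : Cardinal) → c ≤ ‖T - R‖) :
    c ≤ approxNumber T n := by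
  refine le_csInf ⟨‖T - 0‖, 0, ?_, rfl⟩ ?_
  · rw [ContinuousLinearMap.toLinearMap_zero, LinearMap.rank_zero]
    exact_mod_cast Nat.pos_of_ne_zero hn
  · rintro _ ⟨R, hR, rfl⟩
    exact h R hR

theorem approxNumber_eq_zero (T : X →L[ℂ] Y) {n : ℕ}
    (hT : LinearMap.rank (T : X →ₗ[ℂ] Y) < (n : Cardinal)) : approxNumber T n = 0 :=
  le_antisymm (by simpa using approxNumber_le T hT) (approxNumber_nonneg T n)

theorem approxNumber_comp_le (A T B : X →L[ℂ] X) {n : ℕ} (hn : n ≠ 0) :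
    approxNumber (A ∘L T ∘L B) n ≤ (‖A‖ * ‖B‖ + 1) * approxNumber T n := by
  -- The added `1` allows division even when `A` or `B` is zero.
  have hpos : 0 < ‖A‖ * ‖B‖ + 1 := by positivity
  rw [← div_le_iff₀' hpos]
  refine le_approxNumber T hn fun R hR => ?_
  rw [div_le_iff₀' hpos]
  have hR' : LinearMap.rank ((A ∘L R ∘L B : X →L[ℂ] X) : X →ₗ[ℂ] X) < (n : Cardinal) := by
    refine lt_of_le_of_lt ?_ hR
    exact (LinearMap.rank_comp_le_right ((R ∘L B : X →L[ℂ] X) : X →ₗ[ℂ] X) (A : X →ₗ[ℂ] X)).trans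
      (LinearMap.rank_comp_le_left (B : X →ₗ[ℂ] X) (R : X →ₗ[ℂ] X))
  refine (approxNumber_le _ hR').trans ?_
  have e : A ∘L T ∘L B - A ∘L R ∘L B = A ∘L (T - R) ∘L B := by
    ext x
    simp
  rw [e]
  calc ‖A ∘L (T - R) ∘L B‖ ≤ ‖A‖ * (‖T - R‖ * ‖B‖) :=
        (A.opNorm_comp_le _).trans (by gcongr; exact (T - R).opNorm_comp_le B)
    _ ≤ (‖A‖ * ‖B‖ + 1) * ‖T - R‖ := by nlinarith [norm_nonneg (T - R)]

end approxNumber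

/-! ### Dilations -/

theorem HardySpace.norm_le_of_coeff {f g : HardySpace} {c : ℝ} (hc : 0 ≤ c)
    (h : ∀ n, ‖hardyCoeff f n‖ ≤ c * ‖hardyCoeff g n‖) : ‖f‖ ≤ c * ‖g‖ := by
  have hf := lp.hasSum_norm (p := 2) (by norm_num) (hardyCoeff f)
  have hg := (lp.hasSum_norm (p := 2) (by norm_num) (hardyCoeff g)).mul_left (c ^ 2)
  simp only [ENNReal.toReal_ofNat, Real.rpow_ofNat] at hf hg
  rw [← HardySpace.norm_eq] at hf hg
  refine (sq_le_sq₀ (norm_nonneg _) (by positivity)).1 ?_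
  rw [mul_pow]
  refine hasSum_le (fun n => ?_) hf hg
  rw [← mul_pow]
  exact pow_le_pow_left₀ (norm_nonneg _) (h n) 2

theorem hardyCoeff_dilation {φ : 𝔻 → 𝔻} {r : ℝ} (hr0 : 0 ≤ r) (hr1 : r ≤ 1)
    (hφ : ∀ z, (φ z : ℂ) = r * (z : ℂ)) {C : HardySpace →L[ℂ] HardySpace}
    (hC : IsCompositionOperator φ C) (f : HardySpace) (n : ℕ) :
    hardyCoeff (C f) n = (r : ℂ) ^ n * hardyCoeff f n := by
  have hmem : Memℓp (E := fun _ : ℕ => ℂ) (fun n => (r : ℂ) ^ n * hardyCoeff f n) 2 := by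
    have h := (lp.hasSum_norm (p := 2) (by norm_num) (hardyCoeff f)).summable
    rw [memℓp_gen_iff (by norm_num)]
    simp only [ENNReal.toReal_ofNat, Real.rpow_ofNat] at h ⊢
    refine Summable.of_nonneg_of_le (fun n => by positivity) (fun n => ?_) h
    rw [norm_mul, norm_pow, Complex.norm_real, Real.norm_of_nonneg hr0]
    gcongr
    exact mul_le_of_le_one_left (norm_nonneg _) (pow_le_one₀ hr0 hr1)
  have : hardyCoeff (C f) = ⟨_, hmem⟩ := by
    refine hardyCoeff_unique (hasSum_hardyCoeff (C f)) fun z => ?_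
    rw [hC]
    convert! hasSum_hardyCoeff f (φ z) using 2 with n
    rw [hφ, mul_pow]
    ring
  rw [this]

/-- The monomials, as elements of the Hardy space. -/
noncomputable def hardyMonomial (n : ℕ) : HardySpace := hardyEquiv.symm (lp.single 2 n (1 : ℂ))

theorem hardyCoeff_hardyMonomial (n k : ℕ) :
    hardyCoeff (hardyMonomial n) k = if k = n then 1 else 0 := by
  have h : hardyEquiv (hardyMonomial n) = _ := hardyEquiv.apply_symm_apply _
  have h2 := congrArg (fun b : lp (fun _ : ℕ => ℂ) 2 => b k) h
  refine Eq.trans h2 ?_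
  simp [lp.single_apply, Pi.single_apply]

theorem inner_hardyMonomial (n : ℕ) (f : HardySpace) :
    inner ℂ (hardyMonomial n) f = hardyCoeff f n := by
  have h : hardyCoeff (hardyMonomial n) = lp.single 2 n (1 : ℂ) := hardyEquiv.apply_symm_apply _
  rw [HardySpace.inner_eq, h, lp.inner_single_left]
  simp

/-- Approximate `C` by its restriction to the first `n - 1` Taylor coefficients: on the remaining
ones the dilation contracts by at least `r ^ (n - 1)`. -/
theorem approxNumber_dilation_le {φ : 𝔻 → 𝔻} {r : ℝ} (hr0 : 0 < r) (hr1 : r ≤ 1)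
    (hφ : ∀ z, (φ z : ℂ) = r * (z : ℂ)) {C : HardySpace →L[ℂ] HardySpace}
    (hC : IsCompositionOperator φ C) {n : ℕ} (hn : n ≠ 0) :
    approxNumber C n ≤ r⁻¹ * r ^ n := by
  classical
  obtain ⟨m, rfl⟩ := Nat.exists_eq_succ_of_ne_zero hn
  let U : Submodule ℂ HardySpace :=
    Submodule.span ℂ ((Finset.range m).image hardyMonomial : Finset HardySpace)
  have hrank : LinearMap.rank ((C ∘L U.starProjection : HardySpace →L[ℂ] HardySpace) :
      HardySpace →ₗ[ℂ] HardySpace) < ((m + 1 : ℕ) : Cardinal) := by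
    refine lt_of_le_of_lt (LinearMap.rank_comp_le_right
      (U.starProjection : HardySpace →ₗ[ℂ] HardySpace) (C : HardySpace →ₗ[ℂ] HardySpace)) ?_
    have h1 : LinearMap.range (U.starProjection : HardySpace →ₗ[ℂ] HardySpace) = U :=
      Submodule.range_starProjection U
    rw [LinearMap.rank, h1]
    refine lt_of_le_of_lt (rank_span_finset_le _) ?_
    have : ((Finset.range m).image hardyMonomial).card ≤ m :=
      Finset.card_image_le.trans (Finset.card_range m).le
    exact_mod_cast Nat.lt_succ_of_le this
  refine (approxNumber_le C hrank).trans ?_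
  have e : r⁻¹ * r ^ (m + 1) = r ^ m := by
    rw [pow_succ]
    field_simp
  rw [Nat.succ_eq_add_one, e]
  refine ContinuousLinearMap.opNorm_le_bound _ (by positivity) fun f => ?_
  set g := f - U.starProjection f with hg
  have hg1 : (C - C ∘L U.starProjection) f = C g := by simp [hg]
  have hg2 : ‖g‖ ≤ ‖f‖ := by
    rw [hg, ← Submodule.starProjection_orthogonal_val]
    simpa using Uᗮ.starProjection.le_of_opNorm_le Uᗮ.starProjection_norm_le f
  have hg3 : ∀ k < m, hardyCoeff g k = 0 := fun k hk => by
    rw [← inner_hardyMonomial]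
    refine (Submodule.mem_orthogonal _ _).1 (Submodule.sub_starProjection_mem_orthogonal f) _ ?_
    exact Submodule.subset_span (by simpa using ⟨k, hk, rfl⟩)
  rw [hg1]
  refine (HardySpace.norm_le_of_coeff (by positivity) fun k => ?_).trans
    (mul_le_mul_of_nonneg_left hg2 (by positivity))
  rw [hardyCoeff_dilation hr0.le hr1 hφ hC, norm_mul, norm_pow, Complex.norm_real,
    Real.norm_of_nonneg hr0.le]
  rcases lt_or_ge k m with hk | hk
  · rw [hg3 k hk]
    simp
  · gcongr ?_ * _
    exact pow_le_pow_of_le_one hr0.le hr1 hk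

/-- An operator of rank less than `n` kills a nonzero polynomial of degree less than `n`, and the
dilation shrinks such a polynomial by a factor no smaller than `r ^ n`. The loss of one power of `r`
is harmless for n-th roots. -/
theorem le_approxNumber_dilation {φ : 𝔻 → 𝔻} {r : ℝ} (hr0 : 0 < r) (hr1 : r ≤ 1)
    (hφ : ∀ z, (φ z : ℂ) = r * (z : ℂ)) {C : HardySpace →L[ℂ] HardySpace}
    (hC : IsCompositionOperator φ C) {n : ℕ} (hn : n ≠ 0) :
    r ^ n ≤ approxNumber C n := by
  refine le_approxNumber C hn fun R hR => ?_
  let J : (Fin n → ℂ) →ₗ[ℂ] HardySpace :=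
    Fintype.linearCombination ℂ fun i : Fin n => hardyMonomial i
  have hJ : ∀ c k, hardyCoeff (J c) k = ∑ i : Fin n, c i * if k = i then 1 else 0 := fun c k => by
    rw [← inner_hardyMonomial, Fintype.linearCombination_apply, inner_sum]
    refine Finset.sum_congr rfl fun i _ => ?_
    rw [inner_smul_right, inner_hardyMonomial, hardyCoeff_hardyMonomial]
  have hker : ∃ c, c ≠ 0 ∧ R (J c) = 0 := by
    by_contra! hcon
    have hinj : Function.Injective ((R : HardySpace →ₗ[ℂ] HardySpace) ∘ₗ J) := by
      rw [← LinearMap.ker_eq_bot, LinearMap.ker_eq_bot']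
      intro c hc
      by_contra h0
      exact hcon c h0 hc
    have h1 : LinearMap.rank ((R : HardySpace →ₗ[ℂ] HardySpace) ∘ₗ J) = n := by
      rw [LinearMap.rank, rank_range_of_injective _ hinj]
      simp
    exact absurd (h1.symm.le.trans (LinearMap.rank_comp_le_left J _)) hR.not_ge
  obtain ⟨c, hc0, hRc⟩ := hker
  have hg0 : J c ≠ 0 := by
    intro h
    refine hc0 (funext fun i => ?_)
    have h1 := hJ c i
    rw [h] at h1
    have h2 : hardyCoeff (0 : HardySpace) i = 0 := by
      rw [← inner_hardyMonomial, inner_zero_right]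
    rw [h2] at h1
    simpa [Fin.val_inj] using h1.symm
  have hbound : ‖J c‖ ≤ (r ^ n)⁻¹ * ‖C (J c)‖ := by
    refine HardySpace.norm_le_of_coeff (by positivity) fun k => ?_
    rw [hardyCoeff_dilation hr0.le hr1 hφ hC, norm_mul, norm_pow, Complex.norm_real,
      Real.norm_of_nonneg hr0.le, ← mul_assoc]
    rcases lt_or_ge k n with hk | hk
    · refine le_mul_of_one_le_left (norm_nonneg _) ?_
      rw [inv_mul_eq_div, one_le_div (by positivity)]
      exact pow_le_pow_of_le_one hr0.le hr1 hk.le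
    · have : hardyCoeff (J c) k = 0 := by
        rw [hJ]
        refine Finset.sum_eq_zero fun i _ => ?_
        rw [if_neg (by have := i.2; omega), mul_zero]
      rw [this]
      simp
  have h1 : ‖C (J c)‖ ≤ ‖C - R‖ * ‖J c‖ := by
    have := (C - R).le_opNorm (J c)
    rwa [sub_apply, hRc, sub_zero] at this
  rw [← div_eq_inv_mul, le_div_iff₀ (by positivity), mul_comm] at hbound
  exact le_of_mul_le_mul_right (hbound.trans h1) (norm_pos_iff.2 hg0)

/-- Constants disappear under n-th roots. The lower bound is asked only for `t < r`, with a constant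
depending on `t`, because in the tangent case the comparison is with dilations by `t < 1`. -/
theorem tendsto_rpow_inv_of_bounds {x : ℕ → ℝ} {r : ℝ} (hr : 0 < r)
    (hlow : ∀ t, 0 < t → t < r → ∃ c > 0, ∀ n ≠ 0, c * t ^ n ≤ x n)
    (hup : ∃ c > 0, ∀ n ≠ 0, x n ≤ c * r ^ n) :
    Filter.Tendsto (fun n : ℕ => x n ^ (1 / (n : ℝ))) Filter.atTop (𝓝 r) := by
  have hroot : ∀ c > (0 : ℝ), ∀ t > (0 : ℝ),
      Filter.Tendsto (fun n : ℕ => (c * t ^ n) ^ (1 / (n : ℝ))) Filter.atTop (𝓝 t) := by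
    intro c hc t ht
    have h1 : Filter.Tendsto (fun n : ℕ => c ^ (1 / (n : ℝ)) * t) Filter.atTop
        (𝓝 (c ^ (0 : ℝ) * t)) :=
      ((Real.continuousAt_const_rpow hc.ne').tendsto.comp
        tendsto_one_div_atTop_nhds_zero_nat).mul_const t
    rw [Real.rpow_zero, one_mul] at h1
    refine h1.congr' ?_
    filter_upwards [Filter.eventually_ne_atTop 0] with n hn
    rw [Real.mul_rpow hc.le (by positivity), one_div, Real.pow_rpow_inv_natCast ht.le hn]
  rw [tendsto_order]
  constructor
  · intro a ha
    obtain ⟨t, ht1, ht2⟩ := exists_between (max_lt ha hr)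
    have ht0 : 0 < t := (le_max_right _ _).trans_lt ht1
    obtain ⟨c, hc, h⟩ := hlow t ht0 ht2
    filter_upwards [(tendsto_order.1 (hroot c hc t ht0)).1 a ((le_max_left _ _).trans_lt ht1),
      Filter.eventually_ne_atTop 0] with n hn hn0
    exact hn.trans_le (Real.rpow_le_rpow (by positivity) (h n hn0) (by positivity))
  · intro b hb
    obtain ⟨c, hc, h⟩ := hup
    -- Needed only for `0 ≤ x n`, without which `rpow` is not monotone.
    obtain ⟨c', hc', h'⟩ := hlow (r / 2) (by positivity) (by linarith)
    filter_upwards [(tendsto_order.1 (hroot c hc r hr)).2 b hb,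
      Filter.eventually_ne_atTop 0] with n hn hn0
    exact (Real.rpow_le_rpow ((by positivity : (0 : ℝ) ≤ c' * (r / 2) ^ n).trans (h' n hn0))
      (h n hn0) (by positivity)).trans_lt hn

/-! ### The Green capacity of hyperbolic discs -/

section Green

open MeasureTheory

/-- Nonnegativity of the Green function of the disc of radius `ρ`, by rescaling to the unit disc. -/
theorem norm_sub_le_mul_norm_one_sub {ρ : ℝ} (hρ : 0 < ρ) {z w : ℂ} (hz : ‖z‖ < ρ) (hw : ‖w‖ < ρ) :
    ‖z - w‖ ≤ ρ * ‖1 - z * conj w / (ρ : ℂ) ^ 2‖ := by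
  have hρ' : (ρ : ℂ) ≠ 0 := by exact_mod_cast hρ.ne'
  have hd : ∀ {x : ℂ}, ‖x‖ < ρ → ‖x / ρ‖ < 1 := fun {x} hx => by
    rw [norm_div, Complex.norm_real, Real.norm_of_nonneg hρ.le, div_lt_one hρ]
    exact hx
  have h := moebius_norm_lt_one (u := 1) (by simp) (-Complex.UnitDisc.mk _ (hd hw))
    (Complex.UnitDisc.mk _ (hd hz))
  have hne := one_add_conj_mul_ne_zero (-Complex.UnitDisc.mk _ (hd hw))
    (Complex.UnitDisc.mk _ (hd hz))
  rw [norm_div, div_lt_one (norm_pos_iff.2 hne)] at h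
  simp only [Complex.UnitDisc.coe_neg, Complex.UnitDisc.coe_mk, one_mul, map_neg, map_div₀,
    Complex.conj_ofReal] at h
  have e1 : z - w = ρ * (z / ρ + -(w / ρ)) := by field_simp; ring
  have e2 : 1 - z * conj w / (ρ : ℂ) ^ 2 = 1 + -(conj w / ρ) * (z / ρ) := by field_simp; ring
  rw [e1, e2, norm_mul, Complex.norm_real, Real.norm_of_nonneg hρ.le]
  gcongr

/-- Subtracting the Green function of the disc of radius `ρ` leaves a minorant of `greenFunction`
without singularity. -/
theorem le_greenFunction {ρ : ℝ} (hρ : 0 < ρ) {z w : 𝔻} (hz : ‖(z : ℂ)‖ < ρ) (hw : ‖(w : ℂ)‖ < ρ) :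
    ENNReal.ofReal (-Real.log ρ + (Real.log ‖1 - (z : ℂ) * conj (w : ℂ)‖ -
      Real.log ‖1 - (z : ℂ) * conj (w : ℂ) / (ρ : ℂ) ^ 2‖)) ≤ greenFunction z w := by
  unfold greenFunction
  split_ifs with h
  · exact le_top
  refine ENNReal.ofReal_le_ofReal ?_
  have hzw : (z : ℂ) - w ≠ 0 := by rwa [sub_ne_zero, Ne, Complex.UnitDisc.coe_inj]
  have h1 := norm_pos_iff.2 hzw
  have h2 := norm_sub_le_mul_norm_one_sub hρ hz hw
  have h3 : 0 < ‖1 - (z : ℂ) * conj (w : ℂ) / (ρ : ℂ) ^ 2‖ := by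
    by_contra h0
    nlinarith [norm_nonneg (1 - (z : ℂ) * conj (w : ℂ) / (ρ : ℂ) ^ 2)]
  have h4 := Real.log_le_log h1 h2
  rw [Real.log_mul hρ.ne' h3.ne'] at h4
  rw [norm_div, Real.log_div (norm_ne_zero_iff.2 (one_sub_conj_mul_ne_zero z w)) h1.ne',
    mul_comm (conj (w : ℂ))]
  linarith

/-- With `u = z * conj w`, the nonnegative coefficients make this a positive definite kernel. The
term `k = 0` vanishes, as it should, by division by zero. -/
theorem hasSum_log_norm_sub {ρ : ℝ} (hρ : 0 < ρ) (hρ1 : ρ < 1) {u : ℂ} (hu : ‖u‖ < ρ ^ 2) :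
    HasSum (fun k : ℕ => (((ρ ^ 2)⁻¹ ^ k - 1) / k) * (u ^ k).re)
      (Real.log ‖1 - u‖ - Real.log ‖1 - u / (ρ : ℂ) ^ 2‖) := by
  have h1 : ‖u‖ < 1 := hu.trans (by nlinarith)
  have h2 : ‖u / (ρ : ℂ) ^ 2‖ < 1 := by
    rw [norm_div, norm_pow, Complex.norm_real, Real.norm_of_nonneg hρ.le, div_lt_one (by positivity)]
    exact hu
  have h := Complex.hasSum_re ((Complex.hasSum_taylorSeries_neg_log h2).sub
    (Complex.hasSum_taylorSeries_neg_log h1))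
  convert! h using 1
  · ext k
    have : (u / (ρ : ℂ) ^ 2) ^ k / k - u ^ k / k =
        (((((ρ ^ 2)⁻¹ ^ k - 1) / k : ℝ)) : ℂ) * u ^ k := by
      push_cast
      rw [div_pow, inv_pow]
      ring
    rw [this, Complex.re_ofReal_mul]
  · rw [Complex.sub_re, Complex.neg_re, Complex.neg_re, Complex.log_re, Complex.log_re]
    ring

theorem measurable_unitDisc_coe : Measurable ((↑) : 𝔻 → ℂ) :=
  Complex.UnitDisc.continuous_coe.measurable

theorem ofReal_integral_le_lintegral_ofReal {α : Type*} [MeasurableSpace α] {μ : Measure α}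
    {f : α → ℝ} (hf : Integrable f μ) :
    ENNReal.ofReal (∫ x, f x ∂μ) ≤ ∫⁻ x, ENNReal.ofReal (f x) ∂μ := by
  have h := ofReal_integral_eq_lintegral_ofReal hf.pos_part
    (Filter.Eventually.of_forall fun x => le_max_right _ _)
  have e : ∀ x, ENNReal.ofReal (max (f x) 0) = ENNReal.ofReal (f x) := fun x => by
    rw [ENNReal.ofReal_max, ENNReal.ofReal_zero, max_eq_left zero_le]
  simp only [e] at h
  rw [← h]
  exact ENNReal.ofReal_le_ofReal (integral_mono hf hf.pos_part fun x => le_max_left _ _)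

/-- Integrating the minorant termwise leaves `-log ρ + ∑ c k |∫ z ^ k dμ|²`. The gap `r < ρ` gives
uniform convergence; `le_greenEnergy` then lets `ρ` decrease to `r`. -/
theorem le_greenEnergy_of_lt {r ρ : ℝ} (hr : 0 < r) (hrρ : r < ρ) (hρ1 : ρ < 1) (μ : Measure 𝔻)
    [IsProbabilityMeasure μ] (hμ : ∀ᵐ z : 𝔻 ∂μ, ‖(z : ℂ)‖ ≤ r) :
    ENNReal.ofReal (-Real.log ρ) ≤ greenEnergy μ := by
  have hρ : 0 < ρ := hr.trans hrρ
  have hc := measurable_unitDisc_coe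
  set c : ℕ → ℝ := fun k => ((ρ ^ 2)⁻¹ ^ k - 1) / k with hcdef
  have hρ2 : 1 ≤ (ρ ^ 2)⁻¹ := by
    rw [one_le_inv₀ (by positivity)]
    nlinarith
  have hc0 : ∀ k, 0 ≤ c k := fun k =>
    div_nonneg (sub_nonneg.2 (one_le_pow₀ hρ2)) (Nat.cast_nonneg k)
  set F : 𝔻 × 𝔻 → ℝ := fun p => Real.log ‖1 - (p.1 : ℂ) * conj (p.2 : ℂ)‖ -
    Real.log ‖1 - (p.1 : ℂ) * conj (p.2 : ℂ) / (ρ : ℂ) ^ 2‖ with hF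
  have hFm : Measurable F := by
    have h1 : Measurable fun p : 𝔻 × 𝔻 => (p.1 : ℂ) := hc.comp measurable_fst
    have h2 : Measurable fun p : 𝔻 × 𝔻 => conj (p.2 : ℂ) :=
      Complex.continuous_conj.measurable.comp (hc.comp measurable_snd)
    have h3 := h1.mul h2
    exact (Real.measurable_log.comp (measurable_const.sub h3).norm).sub
      (Real.measurable_log.comp (measurable_const.sub (h3.div_const _)).norm)
  have hp : ∀ᵐ p : 𝔻 × 𝔻 ∂μ.prod μ, ‖((p.1 : 𝔻) : ℂ) * conj ((p.2 : 𝔻) : ℂ)‖ ≤ r ^ 2 := by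
    have h1 : ∀ᵐ p : 𝔻 × 𝔻 ∂μ.prod μ, ‖((p.1 : 𝔻) : ℂ)‖ ≤ r :=
      Measure.quasiMeasurePreserving_fst.ae hμ
    have h2 : ∀ᵐ p : 𝔻 × 𝔻 ∂μ.prod μ, ‖((p.2 : 𝔻) : ℂ)‖ ≤ r :=
      Measure.quasiMeasurePreserving_snd.ae hμ
    filter_upwards [h1, h2] with p h1 h2
    rw [norm_mul, RCLike.norm_conj, sq]
    exact mul_le_mul h1 h2 (norm_nonneg _) hr.le
  have hr2 : r ^ 2 < ρ ^ 2 := by gcongr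
  have hsumF : ∀ᵐ p : 𝔻 × 𝔻 ∂μ.prod μ,
      HasSum (fun k => c k * (((p.1 : ℂ) * conj (p.2 : ℂ)) ^ k).re) (F p) := by
    filter_upwards [hp] with p hp
    exact hasSum_log_norm_sub hρ hρ1 (hp.trans_lt hr2)
  have hbsum : Summable fun k => c k * (r ^ 2) ^ k := by
    have := (hasSum_log_norm_sub hρ hρ1 (u := ((r ^ 2 : ℝ) : ℂ))
      (by rwa [Complex.norm_real, Real.norm_of_nonneg (by positivity)])).summable
    refine this.congr fun k => ?_
    rw [← Complex.ofReal_pow, Complex.ofReal_re]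
  have hbound : ∀ k, ∀ᵐ p : 𝔻 × 𝔻 ∂μ.prod μ,
      ‖c k * (((p.1 : ℂ) * conj (p.2 : ℂ)) ^ k).re‖ ≤ c k * (r ^ 2) ^ k := fun k => by
    filter_upwards [hp] with p hp
    rw [norm_mul, Real.norm_of_nonneg (hc0 k)]
    refine mul_le_mul_of_nonneg_left ((Complex.abs_re_le_norm _).trans ?_) (hc0 k)
    rw [norm_pow]
    gcongr
  have hterm_meas : ∀ k, Measurable fun p : 𝔻 × 𝔻 =>
      c k * (((p.1 : ℂ) * conj (p.2 : ℂ)) ^ k).re := fun k => by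
    have h1 : Measurable fun p : 𝔻 × 𝔻 => (p.1 : ℂ) := hc.comp measurable_fst
    have h2 : Measurable fun p : 𝔻 × 𝔻 => conj (p.2 : ℂ) :=
      Complex.continuous_conj.measurable.comp (hc.comp measurable_snd)
    exact (Complex.measurable_re.comp ((h1.mul h2).pow_const k)).const_mul _
  have hint : HasSum (fun k => ∫ p, c k * (((p.1 : ℂ) * conj (p.2 : ℂ)) ^ k).re ∂μ.prod μ)
      (∫ p, F p ∂μ.prod μ) :=
    hasSum_integral_of_dominated_convergence (fun k _ => c k * (r ^ 2) ^ k)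
      (fun k => (hterm_meas k).aestronglyMeasurable) hbound
      (Filter.Eventually.of_forall fun _ => hbsum) (integrable_const _) hsumF
  have hFint : Integrable F (μ.prod μ) := by
    refine Integrable.of_bound hFm.aestronglyMeasurable (∑' k, c k * (r ^ 2) ^ k) ?_
    filter_upwards [hsumF, ae_all_iff.2 hbound] with p h1 h2
    rw [← h1.tsum_eq]
    exact tsum_of_norm_bounded hbsum.hasSum h2
  have hpos : 0 ≤ ∫ p, F p ∂μ.prod μ := by
    refine hint.nonneg fun k => ?_
    rw [integral_const_mul]
    refine mul_nonneg (hc0 k) ?_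
    have hk : Integrable (fun p : 𝔻 × 𝔻 => ((p.1 : ℂ) * conj (p.2 : ℂ)) ^ k) (μ.prod μ) := by
      have h1 : Measurable fun p : 𝔻 × 𝔻 => (p.1 : ℂ) := hc.comp measurable_fst
      have h2 : Measurable fun p : 𝔻 × 𝔻 => conj (p.2 : ℂ) :=
        Complex.continuous_conj.measurable.comp (hc.comp measurable_snd)
      refine Integrable.of_bound ((h1.mul h2).pow_const k).aestronglyMeasurable ((r ^ 2) ^ k) ?_
      filter_upwards [hp] with p hp
      rw [norm_pow]
      gcongr
    have h1 : ∫ p, (((p.1 : ℂ) * conj (p.2 : ℂ)) ^ k).re ∂μ.prod μ =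
        (∫ p, ((p.1 : ℂ) * conj (p.2 : ℂ)) ^ k ∂μ.prod μ).re := integral_re hk
    -- The product measure splits the integral into a moment times its conjugate.
    have h2 : ∫ p, ((p.1 : ℂ) * conj (p.2 : ℂ)) ^ k ∂μ.prod μ =
        (∫ z : 𝔻, (z : ℂ) ^ k ∂μ) * conj (∫ z : 𝔻, (z : ℂ) ^ k ∂μ) := by
      rw [← integral_conj, ← integral_prod_mul]
      simp only [mul_pow, map_pow]
    rw [h1, h2, Complex.mul_conj, Complex.ofReal_re]
    exact Complex.normSq_nonneg _
  have hh : Integrable (fun p => -Real.log ρ + F p) (μ.prod μ) := (integrable_const _).add hFint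
  calc ENNReal.ofReal (-Real.log ρ) ≤ ENNReal.ofReal (∫ p, (-Real.log ρ + F p) ∂μ.prod μ) := by
        refine ENNReal.ofReal_le_ofReal ?_
        rw [integral_add (integrable_const _) hFint]
        simpa using hpos
    _ ≤ ∫⁻ p, ENNReal.ofReal (-Real.log ρ + F p) ∂μ.prod μ := ofReal_integral_le_lintegral_ofReal hh
    _ = ∫⁻ z, ∫⁻ w, ENNReal.ofReal (-Real.log ρ + F (z, w)) ∂μ ∂μ :=
        lintegral_prod _ (measurable_const.add hFm).ennreal_ofReal.aemeasurable
    _ ≤ greenEnergy μ := by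
        refine lintegral_mono_ae ?_
        filter_upwards [hμ] with z hz
        refine lintegral_mono_ae ?_
        filter_upwards [hμ] with w hw
        exact le_greenFunction hρ (hz.trans_lt hrρ) (hw.trans_lt hrρ)

theorem le_greenEnergy {r : ℝ} (hr : 0 < r) (hr1 : r ≤ 1) (μ : Measure 𝔻)
    [IsProbabilityMeasure μ] (hμ : ∀ᵐ z : 𝔻 ∂μ, ‖(z : ℂ)‖ ≤ r) :
    ENNReal.ofReal (-Real.log r) ≤ greenEnergy μ := by
  rcases hr1.eq_or_lt with rfl | hr1
  · simp
  have hcont : Filter.Tendsto (fun ρ => ENNReal.ofReal (-Real.log ρ)) (𝓝[>] r)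
      (𝓝 (ENNReal.ofReal (-Real.log r))) :=
    (ENNReal.continuous_ofReal.tendsto _).comp
      ((Real.continuousAt_log hr.ne').neg.tendsto.mono_left nhdsWithin_le_nhds)
  refine le_of_tendsto hcont ?_
  filter_upwards [Ioo_mem_nhdsGT hr1] with ρ hρ
  exact le_greenEnergy_of_lt hr hρ.1 hρ.2 μ hμ

theorem le_greenV (τ : 𝔻 ≃ₜ 𝔻) (hτ : ∀ z w, greenFunction (τ z) (τ w) = greenFunction z w)
    {r : ℝ} (hr : 0 < r) (hr1 : r ≤ 1) {E : Set 𝔻} (hE : ∀ z, τ z ∈ E → ‖(z : ℂ)‖ ≤ r) :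
    ENNReal.ofReal (-Real.log r) ≤ greenV E := by
  refine le_sInf ?_
  rintro _ ⟨μ, hμ, ⟨L, hLE, hL, hμL⟩, rfl⟩
  have hmeas := τ.symm.continuous.measurable
  have : IsProbabilityMeasure (μ.map τ.symm) := Measure.isProbabilityMeasure_map hmeas.aemeasurable
  have hemb : MeasurableEmbedding τ.symm := τ.symm.measurableEmbedding
  have henergy : greenEnergy (μ.map τ.symm) = greenEnergy μ := by
    unfold greenEnergy greenPotential
    rw [hemb.lintegral_map]
    refine lintegral_congr fun z => ?_
    rw [hemb.lintegral_map]
    refine lintegral_congr fun w => ?_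
    rw [← hτ, τ.apply_symm_apply, τ.apply_symm_apply]
  rw [← henergy]
  refine le_greenEnergy hr hr1 _ ?_
  rw [hemb.ae_map_iff]
  have : ∀ᵐ z ∂μ, z ∈ L := hμL
  filter_upwards [this] with z hz
  exact hE _ (by rw [τ.apply_symm_apply]; exact hLE hz)

/-- The potential of the uniform measure on a circle centred at `0`, on that circle. -/
theorem circleAverage_green {r : ℝ} (hr : 0 < r) (hr1 : r < 1) {z : ℂ} (hz : ‖z‖ = r) :
    CircleIntegrable (fun w => Real.log ‖w - (conj z)⁻¹‖ + Real.log r - Real.log ‖w - z‖) 0 r ∧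
    Real.circleAverage (fun w => Real.log ‖w - (conj z)⁻¹‖ + Real.log r - Real.log ‖w - z‖) 0 r =
      -Real.log r := by
  have h1 : CircleIntegrable (fun w => Real.log ‖w - (conj z)⁻¹‖) 0 r :=
    circleIntegrable_log_norm_sub_const r
  have h2 : CircleIntegrable (fun w => Real.log ‖w - z‖) 0 r :=
    circleIntegrable_log_norm_sub_const r
  have h3 : CircleIntegrable (fun _ : ℂ => Real.log r) 0 r := circleIntegrable_const _ _ _
  refine ⟨(h1.add h3).sub h2, ?_⟩
  have e1 := Real.circleAverage_fun_sub (h1.add h3) h2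
  have e2 := Real.circleAverage_fun_add h1 h3
  have e3 : Real.circleAverage (fun w => Real.log ‖w - z‖) 0 r = Real.log r :=
    circleAverage_log_norm_sub_const_of_mem_closedBall (by simp [hz, abs_of_pos hr])
  -- The reflected point `(conj z)⁻¹` has modulus `r⁻¹ > r`, so it lies outside the circle and the
  -- mean is the value at the centre, `log r⁻¹`.
  have e4 : Real.circleAverage (fun w => Real.log ‖w - (conj z)⁻¹‖) 0 r = -Real.log r := by
    rw [circleAverage_log_norm_sub_const_eq_log_radius_add_posLog hr.ne', zero_sub, norm_neg,
      norm_inv, RCLike.norm_conj, hz, Real.posLog_eq_log, Real.log_mul, Real.log_inv]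
    · ring
    · positivity
    · positivity
    · rw [abs_of_pos (by positivity)]
      have := (one_lt_inv₀ hr).2 hr1
      nlinarith
  refine e1.trans ?_
  have e5 := Real.circleAverage_const (Real.log r) 0 r
  rw [e3]
  refine (congrArg (· - Real.log r) (e2.trans (congrArg₂ (· + ·) e4 e5))).trans ?_
  simp

theorem lintegral_greenFunction_circle {r : ℝ} (hr : 0 < r) (hr1 : r < 1) {γ : ℝ → 𝔻}
    (hγ : ∀ θ, (γ θ : ℂ) = circleMap 0 r θ) (t : ℝ) :
    (ENNReal.ofReal (2 * Real.pi))⁻¹ * ∫⁻ θ in Set.Ioc 0 (2 * Real.pi), greenFunction (γ t) (γ θ) =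
      ENNReal.ofReal (-Real.log r) := by
  have hn : ∀ θ, ‖(γ θ : ℂ)‖ = r := fun θ => by rw [hγ, norm_circleMap_zero, abs_of_pos hr]
  obtain ⟨hi, ha⟩ := circleAverage_green hr hr1 (hn t)
  set G := fun w : ℂ => Real.log ‖w - (conj (γ t : ℂ))⁻¹‖ + Real.log r - Real.log ‖w - γ t‖ with hG
  have hpi : 0 < 2 * Real.pi := by positivity
  -- The parameters where the Green function is infinite form a countable set.
  have hae : ∀ᵐ θ ∂volume.restrict (Set.Ioc 0 (2 * Real.pi)), γ t ≠ γ θ := by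
    refine ae_restrict_of_ae ?_
    have hcount : {θ | circleMap 0 r θ = γ t}.Countable :=
      (Set.countable_singleton (γ t : ℂ)).preimage_circleMap 0 hr.ne'
    filter_upwards [hcount.ae_notMem volume] with θ hθ h
    exact hθ (by rw [h]; exact (hγ θ).symm)
  have heq : ∀ θ, γ t ≠ γ θ → greenFunction (γ t) (γ θ) = ENNReal.ofReal (G (circleMap 0 r θ)) ∧
      0 ≤ G (circleMap 0 r θ) := by
    intro θ hθ
    have hz0 : (γ t : ℂ) ≠ 0 := by rw [← norm_ne_zero_iff, hn]; exact hr.ne'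
    have hz0' : conj (γ t : ℂ) ≠ 0 := by simpa using hz0
    have hzw : (γ t : ℂ) - γ θ ≠ 0 := by rwa [sub_ne_zero, Ne, Complex.UnitDisc.coe_inj]
    have h1 := one_sub_conj_mul_ne_zero (γ t) (γ θ)
    have e1 : ‖1 - conj (γ θ : ℂ) * γ t‖ = ‖(γ θ : ℂ) - (conj (γ t : ℂ))⁻¹‖ * r := by
      have : conj (1 - conj (γ θ : ℂ) * γ t) = -(((γ θ : ℂ) - (conj (γ t : ℂ))⁻¹) * conj (γ t : ℂ)) := by
        rw [sub_mul, inv_mul_cancel₀ hz0']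
        simp
      rw [← RCLike.norm_conj, this, norm_neg, norm_mul, RCLike.norm_conj, hn]
    have e2 : Real.log ‖(1 - conj (γ θ : ℂ) * (γ t : ℂ)) / ((γ t : ℂ) - (γ θ : ℂ))‖ =
        G (circleMap 0 r θ) := by
      have h2 : ‖(γ θ : ℂ) - (conj (γ t : ℂ))⁻¹‖ ≠ 0 := by
        intro h0
        rw [h0, zero_mul] at e1
        exact h1 (norm_eq_zero.1 e1)
      rw [norm_div, Real.log_div (norm_ne_zero_iff.2 h1) (norm_ne_zero_iff.2 hzw), e1,
        Real.log_mul h2 hr.ne', norm_sub_rev, hG, ← hγ θ]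
      simp only [norm_sub_rev]
    refine ⟨by rw [greenFunction, if_neg hθ, e2], ?_⟩
    rw [← e2]
    refine Real.log_nonneg ?_
    rw [norm_div, one_le_div (norm_pos_iff.2 hzw)]
    have := norm_sub_le_mul_norm_one_sub one_pos (γ t).norm_lt_one (γ θ).norm_lt_one
    simpa [mul_comm] using this
  have hi' : Integrable (fun θ => G (circleMap 0 r θ)) (volume.restrict (Set.Ioc 0 (2 * Real.pi))) :=
    (intervalIntegrable_iff_integrableOn_Ioc_of_le hpi.le).1 hi
  rw [lintegral_congr_ae (g := fun θ => ENNReal.ofReal (G (circleMap 0 r θ)))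
    (hae.mono fun θ hθ => (heq θ hθ).1), ← ofReal_integral_eq_lintegral_ofReal hi'
    (hae.mono fun θ hθ => (heq θ hθ).2), ← ENNReal.ofReal_inv_of_pos hpi,
    ← ENNReal.ofReal_mul (by positivity), ← ha, Real.circleAverage_def,
    intervalIntegral.integral_of_le hpi.le, smul_eq_mul]

/-- The test measure is the image under `τ` of the uniform measure on the circle of radius `r`,
whose potential is constant on that circle; only the image of the circle has to lie in `E`. -/
theorem greenV_le (τ : 𝔻 ≃ₜ 𝔻) (hτ : ∀ z w, greenFunction (τ z) (τ w) = greenFunction z w)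
    {r : ℝ} (hr : 0 < r) (hr1 : r < 1) {E : Set 𝔻} (hE : ∀ z : 𝔻, ‖(z : ℂ)‖ = r → τ z ∈ E) :
    greenV E ≤ ENNReal.ofReal (-Real.log r) := by
  have hn : ∀ θ, ‖circleMap 0 r θ‖ = r := fun θ => by rw [norm_circleMap_zero, abs_of_pos hr]
  let γ : ℝ → 𝔻 := fun θ => Complex.UnitDisc.mk (circleMap 0 r θ) (by rw [hn]; exact hr1)
  have hγ : ∀ θ, (γ θ : ℂ) = circleMap 0 r θ := fun θ => rfl
  have hγc : Continuous γ := by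
    rw [Complex.UnitDisc.isEmbedding_coe.continuous_iff]
    exact continuous_circleMap 0 r
  have hpi : 0 < 2 * Real.pi := by positivity
  let P : Measure ℝ := (ENNReal.ofReal (2 * Real.pi))⁻¹ • volume.restrict (Set.Ioc 0 (2 * Real.pi))
  have hP : IsProbabilityMeasure P := by
    constructor
    simp only [P, Measure.smul_apply, Measure.restrict_apply_univ, Real.volume_Ioc, sub_zero,
      smul_eq_mul]
    exact ENNReal.inv_mul_cancel (by simpa using hpi) ENNReal.ofReal_ne_top
  have hm : Measurable (τ ∘ γ) := (τ.continuous.comp hγc).measurable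
  have hprob : IsProbabilityMeasure (P.map (τ ∘ γ)) := Measure.isProbabilityMeasure_map hm.aemeasurable
  have hle : greenV E ≤ greenEnergy (P.map (τ ∘ γ)) := by
    refine sInf_le ⟨P.map (τ ∘ γ), hprob, ⟨(τ ∘ γ) '' Set.Icc 0 (2 * Real.pi), ?_, ?_, ?_⟩,
      rfl⟩
    · rintro _ ⟨θ, -, rfl⟩
      exact hE _ (hn θ)
    · exact isCompact_Icc.image (τ.continuous.comp hγc)
    · have hK : IsCompact ((τ ∘ γ) '' Set.Icc 0 (2 * Real.pi)) :=
        isCompact_Icc.image (τ.continuous.comp hγc)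
      have : T2Space 𝔻 := Complex.UnitDisc.isEmbedding_coe.t2Space
      rw [Measure.map_apply hm hK.isClosed.measurableSet.compl]
      simp only [P, Measure.smul_apply, smul_eq_mul]
      rw [Measure.restrict_apply (hm hK.isClosed.measurableSet.compl)]
      have : (τ ∘ γ) ⁻¹' ((τ ∘ γ) '' Set.Icc 0 (2 * Real.pi))ᶜ ∩ Set.Ioc 0 (2 * Real.pi) = ∅ := by
        rw [Set.eq_empty_iff_forall_notMem]
        rintro θ ⟨h1, h2⟩
        exact h1 ⟨θ, Set.Ioc_subset_Icc_self h2, rfl⟩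
      rw [this, measure_empty, mul_zero]
  refine hle.trans ?_
  -- `lintegral_map_le` holds without measurability of the integrand, and an upper bound is all that
  -- is required.
  calc greenEnergy (P.map (τ ∘ γ)) ≤ ∫⁻ t, greenPotential (P.map (τ ∘ γ)) ((τ ∘ γ) t) ∂P :=
        lintegral_map_le _ _
    _ ≤ ∫⁻ _, ENNReal.ofReal (-Real.log r) ∂P := by
        refine lintegral_mono fun t => (lintegral_map_le _ _).trans ?_
        simp only [Function.comp_apply, hτ, P, lintegral_smul_measure, smul_eq_mul]
        exact (lintegral_greenFunction_circle hr hr1 hγ t).le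
    _ = _ := by simp

theorem greenV_singleton (w : 𝔻) : greenV {w} = ∞ := by
  rw [greenV, sInf_eq_top]
  rintro _ ⟨μ, hμ, ⟨L, hLE, hL, hμL⟩, rfl⟩
  have hw : ∀ᵐ z ∂μ, z = w := by
    have : ∀ᵐ z ∂μ, z ∈ L := hμL
    filter_upwards [this] with z hz
    exact hLE hz
  have h1 : greenPotential μ w = ∞ := by
    rw [greenPotential, lintegral_congr_ae (g := fun _ => ∞)]
    · simp
    · filter_upwards [hw] with z hz
      rw [hz, greenFunction, if_pos rfl]
  rw [greenEnergy, lintegral_congr_ae (g := fun _ => ∞)]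
  · simp
  · filter_upwards [hw] with z hz
    rw [hz, h1]

theorem expNegInv_greenCapacity_of_eq {E : Set 𝔻} {r : ℝ} (hr : 0 < r) (hr1 : r ≤ 1)
    (h : greenV E = ENNReal.ofReal (-Real.log r)) : expNegInv (greenCapacity E) = r := by
  have h0 : 0 ≤ -Real.log r := by linarith [Real.log_nonpos hr.le hr1]
  rw [expNegInv, greenCapacity, one_div, one_div, inv_inv, h, EReal.coe_ennreal_ofReal,
    max_eq_left h0, ← EReal.coe_neg, neg_neg, EReal.exp_coe, Real.exp_log hr,
    ENNReal.toReal_ofReal hr.le]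

theorem expNegInv_greenCapacity_of_top {E : Set 𝔻} (h : greenV E = ∞) :
    expNegInv (greenCapacity E) = 0 := by
  rw [expNegInv, greenCapacity, one_div, one_div, inv_inv, h]
  simp

end Green

/-! ### Linear fractional self-maps of the disc -/

theorem exists_circle_mul_norm (z : ℂ) : ∃ u : Circle, z = (u : ℂ) * (‖z‖ : ℂ) := by
  refine ⟨Circle.exp z.arg, ?_⟩
  rw [Circle.coe_exp, mul_comm]
  exact (Complex.norm_mul_exp_arg_mul_I z).symm

theorem norm_add_norm_le_one {p s : ℂ} (h : ∀ z : 𝔻, ‖p + s * (z : ℂ)‖ < 1) : ‖p‖ + ‖s‖ ≤ 1 := by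
  have h0 : ‖p‖ < 1 := by simpa using h 0
  by_contra! hcon
  have hs : 0 < ‖s‖ := by linarith
  obtain ⟨u, hu⟩ := exists_circle_mul_norm p
  obtain ⟨v, hv⟩ := exists_circle_mul_norm s
  -- At modulus `t`, in the direction where `s z` is aligned with `p`, the value has modulus exactly
  -- `1`.
  set t : ℝ := (1 - ‖p‖) / ‖s‖ with ht
  have ht0 : 0 ≤ t := div_nonneg (by linarith) hs.le
  have ht1 : t < 1 := by rw [ht, div_lt_one hs]; linarith
  have hz : ‖(t : ℂ) * ((u : ℂ) * conj (v : ℂ))‖ < 1 := by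
    rw [norm_mul, norm_mul, RCLike.norm_conj, Circle.norm_coe, Circle.norm_coe, Complex.norm_real,
      Real.norm_of_nonneg ht0]
    simpa
  have h1 := h (Complex.UnitDisc.mk _ hz)
  have hvv : (v : ℂ) * conj (v : ℂ) = 1 := by rw [Complex.mul_conj', Circle.norm_coe]; norm_num
  have e : p + s * ((t : ℂ) * ((u : ℂ) * conj (v : ℂ))) = (u : ℂ) * ((‖p‖ + ‖s‖ * t : ℝ) : ℂ) := by
    push_cast
    linear_combination hu + (t : ℂ) * u * conj (v : ℂ) * hv + (‖s‖ : ℂ) * t * u * hvv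
  have e2 : ‖p‖ + ‖s‖ * t = 1 := by rw [ht]; field_simp; ring
  rw [Complex.UnitDisc.coe_mk, e, e2, norm_mul, Circle.norm_coe] at h1
  simp at h1

theorem norm_le_of_linearFractional {a b c d : ℂ}
    (h : ∀ z : 𝔻, c * (z : ℂ) + d ≠ 0 ∧ ‖(a * (z : ℂ) + b) / (c * (z : ℂ) + d)‖ < 1)
    {z : ℂ} (hz : ‖z‖ ≤ 1) : ‖a * z + b‖ ≤ ‖c * z + d‖ := by
  have hball : z ∈ closure (Metric.ball (0 : ℂ) 1) := by
    rw [closure_ball _ one_ne_zero]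
    simpa using hz
  refine le_on_closure (f := fun z => ‖a * z + b‖) (g := fun z => ‖c * z + d‖) (fun w hw => ?_)
    (by fun_prop) (by fun_prop) hball
  obtain ⟨h1, h2⟩ := h (Complex.UnitDisc.mk w (by simpa using hw))
  rw [norm_div, div_lt_one (norm_pos_iff.2 h1)] at h2
  exact h2.le

theorem norm_le_norm_of_ne_zero {c d : ℂ} (h : ∀ z : 𝔻, c * (z : ℂ) + d ≠ 0) : ‖c‖ ≤ ‖d‖ := by
  by_contra! hlt
  have hc : 0 < ‖c‖ := (norm_nonneg d).trans_lt hlt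
  have hc0 := norm_pos_iff.1 hc
  refine h (Complex.UnitDisc.mk (-d / c) ?_) ?_
  · rwa [norm_div, norm_neg, div_lt_one hc]
  · rw [Complex.UnitDisc.coe_mk]
    field_simp
    ring

/-- If `‖c‖ = ‖d‖`, the pole `-d / c` is on the unit circle; there `‖az+b‖ ≤ ‖cz+d‖` persists by
continuity, so numerator and denominator vanish together and the determinant is zero. -/
theorem norm_lt_norm_of_linearFractional {a b c d : ℂ} (hdet : a * d - b * c ≠ 0)
    (h : ∀ z : 𝔻, c * (z : ℂ) + d ≠ 0 ∧ ‖(a * (z : ℂ) + b) / (c * (z : ℂ) + d)‖ < 1) :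
    ‖c‖ < ‖d‖ := by
  have hle := norm_le_norm_of_ne_zero fun z => (h z).1
  refine hle.lt_of_ne fun heq => ?_
  have hd : d ≠ 0 := by simpa using (h 0).1
  have hc : c ≠ 0 := by rw [← norm_ne_zero_iff, heq]; exact norm_ne_zero_iff.2 hd
  have h1 := norm_le_of_linearFractional h (z := -d / c)
    (by rw [norm_div, norm_neg, heq, div_self (norm_ne_zero_iff.2 hd)])
  have h2 : c * (-d / c) + d = 0 := by field_simp; ring
  rw [h2, norm_zero, norm_le_zero_iff] at h1
  refine hdet ?_
  field_simp at h1
  linear_combination -h1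

/-- The constant term is the centre of the image disc: the value at `-conj c / conj d`, the
reflection of the pole in the unit circle. This point is the zero of `moebius 1 e`. -/
theorem linearFractional_eq {a b c d : ℂ} (h : ‖c‖ < ‖d‖) :
    ∃ e : 𝔻, ∀ z : 𝔻, (a * (z : ℂ) + b) / (c * (z : ℂ) + d) =
      (b * conj d - a * conj c) / (d * conj d - c * conj c) +
        (a * d - b * c) * conj d / (d * (d * conj d - c * conj c)) * (moebius 1 e z : ℂ) := by
  have hd0 : 0 < ‖d‖ := (norm_nonneg c).trans_lt h
  have hd : d ≠ 0 := norm_pos_iff.1 hd0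
  have hd' : conj d ≠ 0 := by simpa using hd
  have hN : d * conj d - c * conj c ≠ 0 := by
    rw [Complex.mul_conj', Complex.mul_conj']
    have : ‖c‖ ^ 2 < ‖d‖ ^ 2 := by gcongr
    exact_mod_cast (sub_pos.2 this).ne'
  have he : ‖conj (c / d)‖ < 1 := by rwa [RCLike.norm_conj, norm_div, div_lt_one hd0]
  refine ⟨Complex.UnitDisc.mk _ he, fun z => ?_⟩
  have h1 := one_add_conj_mul_ne_zero (Complex.UnitDisc.mk _ he) z
  rw [coe_moebius]
  rw [Complex.UnitDisc.coe_mk, Complex.conj_conj] at h1 ⊢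
  have h2 : c * (z : ℂ) + d ≠ 0 := by
    intro h0
    refine h1 ?_
    field_simp
    linear_combination h0
  have h3 : 1 + c / d * (z : ℂ) = (c * z + d) / d := by field_simp; ring
  rw [h3, map_div₀, Circle.coe_one, one_mul]
  generalize conj d = d' at *
  generalize conj c = c' at *
  have h4 : ((z : ℂ) + c' / d') / ((c * z + d) / d) = d * (z * d' + c') / (d' * (c * z + d)) := by
    field_simp
  rw [h4, div_mul_div_comm, div_add_div _ _ hN (by positivity), div_eq_div_iff h2 (by positivity)]
  ring

/-- A nonconstant linear fractional self-map of the disc is an affine map after an automorphism. -/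
theorem exists_affine_moebius {φ : 𝔻 → 𝔻} {a b c d : ℂ} (hdet : a * d - b * c ≠ 0)
    (h : ‖c‖ < ‖d‖) (hφ : ∀ z : 𝔻, (φ z : ℂ) = (a * (z : ℂ) + b) / (c * (z : ℂ) + d)) :
    ∃ (e : 𝔻) (p s : ℂ), s ≠ 0 ∧ ‖p‖ + ‖s‖ ≤ 1 ∧ ‖p‖ < 1 ∧
      p = (b * conj d - a * conj c) / (d * conj d - c * conj c) ∧
      ∀ z, (φ z : ℂ) = p + s * (moebius 1 e z : ℂ) := by
  obtain ⟨e, he⟩ := linearFractional_eq (a := a) (b := b) h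
  have hd : d ≠ 0 := norm_pos_iff.1 ((norm_nonneg c).trans_lt h)
  have hN : d * conj d - c * conj c ≠ 0 := by
    rw [Complex.mul_conj', Complex.mul_conj']
    have : ‖c‖ ^ 2 < ‖d‖ ^ 2 := by gcongr
    exact_mod_cast (sub_pos.2 this).ne'
  have hs : (a * d - b * c) * conj d / (d * (d * conj d - c * conj c)) ≠ 0 :=
    div_ne_zero (mul_ne_zero hdet (by simpa using hd)) (mul_ne_zero hd hN)
  have hps := norm_add_norm_le_one (p := (b * conj d - a * conj c) / (d * conj d - c * conj c))
    (s := (a * d - b * c) * conj d / (d * (d * conj d - c * conj c))) fun z => by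
      have := (φ ((moebius 1 e).symm z)).norm_lt_one
      rwa [hφ, he, Homeomorph.apply_symm_apply] at this
  exact ⟨e, _, _, hs, hps, by linarith [norm_pos_iff.2 hs], rfl, fun z => (hφ z).trans (he z)⟩

theorem exists_compositionOperator_linearFractional {φ : 𝔻 → 𝔻} {a b c d : ℂ}
    (hdet : a * d - b * c ≠ 0) (h : ‖c‖ < ‖d‖)
    (hφ : ∀ z : 𝔻, (φ z : ℂ) = (a * (z : ℂ) + b) / (c * (z : ℂ) + d)) :
    ∃ C, IsCompositionOperator φ C := by
  obtain ⟨e, p, s, -, hps, hp, -, hz⟩ := exists_affine_moebius hdet h hφ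
  obtain ⟨S, hS⟩ := exists_compositionOperator_moebius 1 e
  obtain ⟨T, hT⟩ := exists_compositionOperator_affine (φ := φ ∘ (moebius 1 e).symm) hp hps
    fun z => by rw [Function.comp_apply, hz, Homeomorph.apply_symm_apply]
  refine ⟨S ∘L T, ?_⟩
  have := hS.comp hT
  rwa [Function.comp_assoc, Homeomorph.symm_comp_self, Function.comp_id] at this

theorem exists_dilation {t : ℝ} (ht0 : 0 ≤ t) (ht1 : t ≤ 1) :
    ∃ δ : 𝔻 → 𝔻, (∀ z, (δ z : ℂ) = t * (z : ℂ)) ∧ ∃ D, IsCompositionOperator δ D := by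
  have h : ∀ z : 𝔻, ‖(t : ℂ) * (z : ℂ)‖ < 1 := fun z => by
    rw [norm_mul, Complex.norm_real, Real.norm_of_nonneg ht0]
    exact (mul_le_of_le_one_left (norm_nonneg _) ht1).trans_lt z.norm_lt_one
  refine ⟨fun z => Complex.UnitDisc.mk _ (h z), fun z => rfl, ?_⟩
  exact exists_compositionOperator_affine (p := 0) (s := t) (by simp)
    (by simpa [abs_of_nonneg ht0] using ht1) fun z => by simp

theorem exists_compositionOperator_moebius_symm (u : Circle) (a : 𝔻) :
    ∃ C, IsCompositionOperator (moebius u a).symm C := by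
  rw [moebius_symm]
  exact exists_compositionOperator_moebius _ _

/-! ### The decay rate of the approximation numbers -/

/-- If `φ` factors through the dilation by `r` up to automorphisms, and the dilations by `t < r`
factor through `φ`, then both the decay rate of the approximation numbers and the capacity of the
range are those of the disc of radius `r`. -/
theorem tendsto_approxNumber_of_factorization {φ : 𝔻 → 𝔻} {C : HardySpace →L[ℂ] HardySpace}
    (hC : IsCompositionOperator φ C) {r : ℝ} (hr : 0 < r) (hr1 : r ≤ 1)
    (hlow : ∀ t, 0 < t → t < r → ∃ (u : Circle) (a : 𝔻) (δ σ : 𝔻 → 𝔻) (S : _),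
      (∀ z, (δ z : ℂ) = t * (z : ℂ)) ∧ IsCompositionOperator σ S ∧ ∀ z, φ (σ z) = moebius u a (δ z))
    (hup : ∃ (u : Circle) (a : 𝔻) (δ χ : 𝔻 → 𝔻) (S : _),
      (∀ z, (δ z : ℂ) = r * (z : ℂ)) ∧ IsCompositionOperator χ S ∧
        ∀ z, φ z = moebius u a (δ (χ z))) :
    Filter.Tendsto (fun n : ℕ => approxNumber C n ^ (1 / (n : ℝ))) Filter.atTop
      (𝓝 (expNegInv (greenCapacity (closure (Set.range φ))))) := by
  have hV : greenV (closure (Set.range φ)) = ENNReal.ofReal (-Real.log r) := by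
    refine le_antisymm ?_ ?_
    -- Circles of radius `ρ < t < r` lie in the image of the dilation by `t`, so up to an
    -- automorphism they lie in the range of `φ`; then `ρ` increases to `r`.
    · have hcont : Filter.Tendsto (fun ρ => ENNReal.ofReal (-Real.log ρ)) (𝓝[<] r)
          (𝓝 (ENNReal.ofReal (-Real.log r))) :=
        (ENNReal.continuous_ofReal.tendsto _).comp
          ((Real.continuousAt_log hr.ne').neg.tendsto.mono_left nhdsWithin_le_nhds)
      refine ge_of_tendsto hcont ?_
      filter_upwards [Ioo_mem_nhdsLT hr] with ρ hρ
      obtain ⟨t, ht1, ht2⟩ := exists_between hρ.2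
      have ht0 : 0 < t := hρ.1.trans ht1
      obtain ⟨u, a, δ, σ, -, hδ, -, hφ⟩ := hlow t ht0 ht2
      refine greenV_le (moebius u a) (greenFunction_moebius u a) hρ.1 (hρ.2.trans_le hr1)
        fun z hz => subset_closure ?_
      have hzt : ‖(z : ℂ) / t‖ < 1 := by
        rw [norm_div, hz, Complex.norm_real, Real.norm_of_nonneg ht0.le, div_lt_one ht0]
        exact ht1
      have hδz : δ (Complex.UnitDisc.mk _ hzt) = z := by
        apply Complex.UnitDisc.coe_injective
        rw [hδ, Complex.UnitDisc.coe_mk]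
        exact mul_div_cancel₀ _ (by exact_mod_cast ht0.ne')
      rw [← hδz, ← hφ]
      exact ⟨_, rfl⟩
    · obtain ⟨u, a, δ, χ, -, hδ, -, hφ⟩ := hup
      refine le_greenV (moebius u a) (greenFunction_moebius u a) hr hr1 fun z hz => ?_
      have hclosed : IsClosed {x : 𝔻 | ‖((moebius u a).symm x : ℂ)‖ ≤ r} :=
        isClosed_le (Complex.UnitDisc.continuous_coe.comp (moebius u a).symm.continuous).norm
          continuous_const
      have hsub : Set.range φ ⊆ {x : 𝔻 | ‖((moebius u a).symm x : ℂ)‖ ≤ r} := by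
        rintro _ ⟨y, rfl⟩
        rw [Set.mem_ofPred_eq, hφ, Homeomorph.symm_apply_apply, hδ, norm_mul, Complex.norm_real,
          Real.norm_of_nonneg hr.le]
        exact mul_le_of_le_one_right hr.le (χ y).norm_lt_one.le
      have := closure_minimal hsub hclosed hz
      rwa [Set.mem_ofPred_eq, Homeomorph.symm_apply_apply] at this
  rw [expNegInv_greenCapacity_of_eq hr hr1 hV]
  refine tendsto_rpow_inv_of_bounds hr (fun t ht0 ht => ?_) ?_
  · obtain ⟨u, a, δ, σ, S, hδ, hS, hφ⟩ := hlow t ht0 ht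
    obtain ⟨T, hT⟩ := exists_compositionOperator_moebius_symm u a
    have hD : IsCompositionOperator δ (S ∘L C ∘L T) := by
      have h1 := hS.comp (hC.comp hT)
      have h2 : ((moebius u a).symm ∘ φ) ∘ σ = δ := by
        ext z
        simp only [Function.comp_apply, hφ, Homeomorph.symm_apply_apply]
      rwa [h2] at h1
    have hpos : 0 < ‖S‖ * ‖T‖ + 1 := by positivity
    refine ⟨(‖S‖ * ‖T‖ + 1)⁻¹, by positivity, fun n hn => ?_⟩
    rw [inv_mul_le_iff₀ hpos]
    exact (le_approxNumber_dilation ht0 (ht.le.trans hr1) hδ hD hn).trans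
      (approxNumber_comp_le S C T hn)
  · obtain ⟨u, a, δ, χ, S, hδ, hS, hφ⟩ := hup
    obtain ⟨T, hT⟩ := exists_compositionOperator_moebius u a
    obtain ⟨δ', hδ', D, hD⟩ := exists_dilation hr.le hr1
    have hCe : C = S ∘L D ∘L T := by
      refine hC.unique ?_
      have h1 := hS.comp (hD.comp hT)
      have h2 : (moebius u a ∘ δ') ∘ χ = φ := by
        ext z
        have : δ' (χ z) = δ (χ z) := Complex.UnitDisc.coe_injective ((hδ' _).trans (hδ _).symm)
        simp only [Function.comp_apply, hφ, this]
      rwa [h2] at h1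
    refine ⟨(‖S‖ * ‖T‖ + 1) * r⁻¹, by positivity, fun n hn => ?_⟩
    rw [hCe, mul_assoc]
    exact (approxNumber_comp_le S D T hn).trans
      (mul_le_mul_of_nonneg_left (approxNumber_dilation_le hr hr1 hδ' hD hn) (by positivity))

theorem tendsto_approxNumber_of_const {φ : 𝔻 → 𝔻} {C : HardySpace →L[ℂ] HardySpace}
    (hC : IsCompositionOperator φ C) {w : 𝔻} (hφ : ∀ z, φ z = w) :
    Filter.Tendsto (fun n : ℕ => approxNumber C n ^ (1 / (n : ℝ))) Filter.atTop
      (𝓝 (expNegInv (greenCapacity (closure (Set.range φ))))) := by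
  have hT : T2Space 𝔻 := Complex.UnitDisc.isEmbedding_coe.t2Space
  have hrange : Set.range φ = {w} := by
    rw [funext hφ]
    exact Set.range_const
  rw [hrange, closure_singleton, expNegInv_greenCapacity_of_top (greenV_singleton w)]
  -- `hardyKernel 0` is the constant function `1`, so `C` has rank at most one and its approximation
  -- numbers vanish from `n = 2` on.
  have hCf : ∀ f, C f = f w • hardyKernel 0 := fun f => by
    ext z
    rw [hC, hφ, HardySpace.smul_apply, hardyKernel_apply]
    simp
  have hrank : LinearMap.rank (C : HardySpace →ₗ[ℂ] HardySpace) ≤ 1 := by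
    have hle : LinearMap.range (C : HardySpace →ₗ[ℂ] HardySpace) ≤ Submodule.span ℂ {hardyKernel 0} := by
      rintro _ ⟨f, rfl⟩
      exact Submodule.mem_span_singleton.2 ⟨f w, (hCf f).symm⟩
    refine (Submodule.rank_mono hle).trans ((rank_span_le _).trans ?_)
    simp
  refine tendsto_const_nhds.congr' ?_
  filter_upwards [Filter.eventually_ge_atTop 2] with n hn
  have h1 : LinearMap.rank (C : HardySpace →ₗ[ℂ] HardySpace) < (n : Cardinal) :=
    hrank.trans_lt (by exact_mod_cast hn)
  rw [approxNumber_eq_zero C h1, Real.zero_rpow]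
  have : (n : ℝ) ≠ 0 := by exact_mod_cast (by omega : n ≠ 0)
  positivity

/-! ### Discs inside the disc -/

/-- With `w = α + iβ`, this places `(w + x) / (1 + x w)` in the disc of centre `P` tangent to the
unit circle at `1`. The right side minus the left is `1 - x` times the quantity in `h6`, which tends
to `2 (1 - P)(1 - |w|²)` as `x → 1`. -/
theorem normSq_horocycle_lt {P t x α β : ℝ} (hP0 : 0 ≤ P) (hP1 : P < 1) (hx1 : x < 1)
    (hx0 : 0 < x) (ht0 : 0 < t) (ht1 : t < 1) (hx : 4 * P * (1 - x) < (1 - t ^ 2) * (1 + x - 2 * P))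
    (hw : α ^ 2 + β ^ 2 ≤ t ^ 2) :
    (α + x - P * (1 + x * α)) ^ 2 + (β - P * (x * β)) ^ 2 <
      (1 - P) ^ 2 * ((1 + x * α) ^ 2 + (x * β) ^ 2) := by
  have hα : -1 ≤ α := by nlinarith [sq_nonneg β]
  have h1 : 0 ≤ 1 + x - 2 * P * x := by nlinarith
  have h2 : (α ^ 2 + β ^ 2) * (1 + x - 2 * P * x) ≤ t ^ 2 * (1 + x - 2 * P * x) :=
    mul_le_mul_of_nonneg_right hw h1
  have h3 : 0 ≤ P * (1 - x) := mul_nonneg hP0 (by linarith)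
  have h4 : 0 ≤ (α + 1) * (P * (1 - x)) := mul_nonneg (by linarith) h3
  have h5 : t ^ 2 * (P * (1 - x)) ≤ P * (1 - x) := mul_le_of_le_one_left h3 (by nlinarith)
  have h6 : 0 < (1 + x - 2 * P) - (α ^ 2 + β ^ 2) * (1 + x - 2 * P * x) +
      2 * α * (P * (1 - x)) := by
    have e : t ^ 2 * (1 + x - 2 * P * x) = t ^ 2 * (1 + x - 2 * P) + 2 * (t ^ 2 * (P * (1 - x))) := by
      ring
    nlinarith
  have h7 := mul_pos (sub_pos.2 hx1) h6
  nlinarith [h7]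

/-- A disc tangent to the unit circle contains hyperbolic discs of every radius `t < 1`. -/
theorem norm_moebius_sub_lt {p : ℂ} {u : Circle} (hu : p = u * (‖p‖ : ℂ)) (hp : ‖p‖ < 1) {t : ℝ}
    (ht0 : 0 < t) (ht1 : t < 1) :
    ∃ x : ℝ, 0 < x ∧ x < 1 ∧ ∀ w : ℂ, ‖w‖ ≤ t → ‖u * (w + x) / (1 + x * w) - p‖ < 1 - ‖p‖ := by
  set P := ‖p‖ with hPdef
  have hP0 : 0 ≤ P := norm_nonneg p
  have hη : 0 < (1 - t ^ 2) * (1 - P) := mul_pos (by nlinarith) (by linarith)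
  have hη1 : (1 - t ^ 2) * (1 - P) ≤ 1 := by nlinarith [sq_nonneg t]
  -- With `η = (1 - t²)(1 - P)`, the condition `4P(1 - x) < (1 - t²)(1 + x - 2P)` has left side at
  -- most `4η/5` and right side at least `9η/5`.
  set x := 1 - (1 - t ^ 2) * (1 - P) / 5 with hx
  have hx1 : x < 1 := by linarith
  have hx0 : 0 < x := by linarith
  refine ⟨x, hx0, hx1, fun w hw => ?_⟩
  have hne : 1 + (x : ℂ) * w ≠ 0 := by
    intro h0
    have h1 : ‖(x : ℂ) * w‖ = 1 := by
      rw [eq_neg_of_add_eq_zero_right h0]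
      simp
    rw [norm_mul, Complex.norm_real, Real.norm_of_nonneg hx0.le] at h1
    nlinarith [norm_nonneg w]
  have e : u * (w + x) / (1 + x * w) - p = u * ((w + x - P * (1 + x * w)) / (1 + x * w)) := by
    nth_rewrite 1 [hu]
    rw [sub_div _ _ (1 + (x : ℂ) * w), mul_div_cancel_right₀ _ hne]
    ring
  rw [e, norm_mul, Circle.norm_coe, one_mul, norm_div, div_lt_iff₀ (norm_pos_iff.2 hne)]
  refine (sq_lt_sq₀ (norm_nonneg _) (mul_nonneg (by linarith) (norm_nonneg _))).1 ?_
  rw [mul_pow, Complex.sq_norm, Complex.sq_norm, Complex.normSq_apply, Complex.normSq_apply]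
  have hw2 : w.re ^ 2 + w.im ^ 2 ≤ t ^ 2 := by
    have := Complex.sq_norm w
    rw [Complex.normSq_apply] at this
    nlinarith [norm_nonneg w]
  have key := normSq_horocycle_lt hP0 hp hx1 hx0 ht0 ht1 (by nlinarith [sq_nonneg t]) hw2
  simp only [Complex.add_re, Complex.add_im, Complex.sub_re, Complex.sub_im, Complex.mul_re,
    Complex.mul_im, Complex.ofReal_re, Complex.ofReal_im, Complex.one_re, Complex.one_im, zero_mul,
    sub_zero, add_zero, zero_add]
  nlinarith [key]

/-- The hyperbolic centre of a disc whose closure lies in the unit disc. -/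
theorem exists_hyperbolicCenter {p s : ℂ} (h : ‖p‖ + ‖s‖ < 1) :
    ∃ α : 𝔻, (p - α) * (1 - α * conj p) + s * (α * conj s) = 0 := by
  set P := ‖p‖ with hP
  set S := ‖s‖ with hS
  have hP0 : 0 ≤ P := norm_nonneg p
  have hS0 : 0 ≤ S := norm_nonneg s
  -- Seeking `α = t p` with `t` real reduces the equation to `P² t² - B t + 1 = 0`. The form `2 / (B
  -- + Δ)` is the smaller root when `P ≠ 0`, which ensures `t P < 1`, and it also covers `P = 0`.
  set B := 1 + P ^ 2 - S ^ 2 with hB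
  have hB1 : 2 * P < B := by nlinarith
  set Δ := Real.sqrt (B ^ 2 - 4 * P ^ 2) with hΔ
  have hΔ0 : 0 ≤ Δ := Real.sqrt_nonneg _
  have hΔ2 : Δ ^ 2 = B ^ 2 - 4 * P ^ 2 := Real.sq_sqrt (by nlinarith)
  have hpos : 0 < B + Δ := by linarith
  set t := 2 / (B + Δ) with ht
  have ht0 : 0 < t := by positivity
  have htP : t * P < 1 := by
    rw [ht, div_mul_eq_mul_div, div_lt_one hpos]
    linarith
  have hroot : P ^ 2 * t ^ 2 - B * t + 1 = 0 := by
    rw [ht]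
    field_simp
    linear_combination hΔ2
  have hα : ‖(t : ℂ) * p‖ < 1 := by
    rwa [norm_mul, Complex.norm_real, Real.norm_of_nonneg ht0.le]
  refine ⟨Complex.UnitDisc.mk _ hα, ?_⟩
  rw [Complex.UnitDisc.coe_mk]
  have h1 : p * conj p = (P : ℂ) ^ 2 := Complex.mul_conj' p
  have h2 : s * conj s = (S : ℂ) ^ 2 := Complex.mul_conj' s
  have hroot' : (P : ℂ) ^ 2 * (t : ℂ) ^ 2 - (1 + (P : ℂ) ^ 2 - (S : ℂ) ^ 2) * t + 1 = 0 := by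
    exact_mod_cast hroot
  linear_combination p * hroot' + ((t : ℂ) ^ 2 * p - t * p) * h1 + t * p * h2

theorem coe_moebius_symm_one_neg (α z : 𝔻) : (moebius 1 (-α)).symm z = moebius 1 α z := by
  rw [moebius_symm]
  simp

/-- A disc whose closure lies in the unit disc is a hyperbolic disc. -/
theorem exists_moebius_dilation_of_affine {ℓ : 𝔻 → 𝔻} {p s : ℂ} (hs : s ≠ 0)
    (hps : ‖p‖ + ‖s‖ < 1) (hℓ : ∀ z, (ℓ z : ℂ) = p + s * (z : ℂ)) :
    ∃ (r : ℝ) (_ : 0 < r) (_ : r ≤ 1) (u : Circle) (α e : 𝔻) (δ : 𝔻 → 𝔻),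
      (∀ z, (δ z : ℂ) = r * (z : ℂ)) ∧ ∀ z, ℓ z = moebius 1 α (δ (moebius u e z)) := by
  obtain ⟨α, hα⟩ := exists_hyperbolicCenter hps
  have hαn := α.norm_lt_one
  have hp : ‖p‖ < 1 := by linarith [norm_nonneg s]
  have hlt : ‖-conj (α : ℂ) * s‖ < ‖1 - conj (α : ℂ) * p‖ := by
    have h1 : 1 - ‖(α : ℂ)‖ * ‖p‖ ≤ ‖1 - conj (α : ℂ) * p‖ := by
      have := norm_sub_norm_le (1 : ℂ) (conj (α : ℂ) * p)
      simpa using this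
    rw [norm_mul, norm_neg, RCLike.norm_conj]
    nlinarith [norm_nonneg (α : ℂ), norm_nonneg p, norm_nonneg s]
  have hdet : s * (1 - conj (α : ℂ) * p) - (p - α) * (-conj (α : ℂ) * s) ≠ 0 := by
    have : s * (1 - conj (α : ℂ) * p) - (p - α) * (-conj (α : ℂ) * s) =
        s * (1 - conj (α : ℂ) * α) := by ring
    rw [this]
    exact mul_ne_zero hs (one_sub_conj_mul_ne_zero α α)
  -- The equation for `α` says precisely that moving `α` to `0` centres the image disc at `0`. What
  -- remains is `s'` times an automorphism: its modulus is `r` and its argument goes into `u`.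
  obtain ⟨e, p', s', hs', hps', -, hp', hfac⟩ := exists_affine_moebius
    (φ := fun z => moebius 1 (-α) (ℓ z)) hdet hlt fun z => by
      rw [coe_moebius, hℓ, Circle.coe_one, one_mul, Complex.UnitDisc.coe_neg, map_neg]
      congr 1 <;> ring
  have hp0 : p' = 0 := by
    rw [hp', div_eq_zero_iff]
    left
    simp only [map_sub, map_mul, map_neg, map_one, Complex.conj_conj]
    linear_combination hα
  rw [hp0] at hps' hfac
  obtain ⟨u, hu⟩ := exists_circle_mul_norm s'
  have hr1 : ‖s'‖ ≤ 1 := by simpa using hps'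
  obtain ⟨δ, hδ, -⟩ := exists_dilation (norm_nonneg s') hr1
  refine ⟨‖s'‖, norm_pos_iff.2 hs', hr1, u, α, e, δ, hδ, fun z => ?_⟩
  rw [← coe_moebius_symm_one_neg]
  refine (moebius 1 (-α)).injective ?_
  rw [Homeomorph.apply_symm_apply]
  apply Complex.UnitDisc.coe_injective
  rw [hfac z, hδ, coe_moebius, coe_moebius]
  nth_rewrite 1 [hu]
  rw [Circle.coe_one]
  ring

theorem tendsto_approxNumber_linearFractional {φ : 𝔻 → 𝔻} {a b c d : ℂ}
    (hdet : a * d - b * c ≠ 0) (h : ‖c‖ < ‖d‖)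
    (hφ : ∀ z : 𝔻, (φ z : ℂ) = (a * (z : ℂ) + b) / (c * (z : ℂ) + d))
    {C : HardySpace →L[ℂ] HardySpace} (hC : IsCompositionOperator φ C) :
    Filter.Tendsto (fun n : ℕ => approxNumber C n ^ (1 / (n : ℝ))) Filter.atTop
      (𝓝 (expNegInv (greenCapacity (closure (Set.range φ))))) := by
  obtain ⟨e, p, s, hs, hps, hp, -, hfac⟩ := exists_affine_moebius hdet h hφ
  obtain ⟨E, hE⟩ := exists_compositionOperator_moebius 1 e
  obtain ⟨E', hE'⟩ := exists_compositionOperator_moebius_symm 1 e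
  rcases hps.lt_or_eq with hlt | heq
  · have hℓ : ∀ z, ((φ ∘ (moebius 1 e).symm) z : ℂ) = p + s * (z : ℂ) := fun z => by
      rw [Function.comp_apply, hfac, Homeomorph.apply_symm_apply]
    obtain ⟨r, hr, hr1, u, α, e', δ, hδ, hfac'⟩ := exists_moebius_dilation_of_affine hs hlt hℓ
    obtain ⟨U, hU⟩ := exists_compositionOperator_moebius u e'
    obtain ⟨U', hU'⟩ := exists_compositionOperator_moebius_symm u e'
    have hφ' : ∀ z, φ z = moebius 1 α (δ (moebius u e' (moebius 1 e z))) := fun z => by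
      rw [← hfac', Function.comp_apply, Homeomorph.symm_apply_apply]
    refine tendsto_approxNumber_of_factorization hC hr hr1 (fun t ht0 ht => ?_)
      ⟨1, α, δ, _, _, hδ, hE.comp hU, hφ'⟩
    -- The dilation by `t` is the one by `r` after the one by `t / r`, and the automorphisms on the
    -- right are undone by their inverses.
    obtain ⟨δ₁, hδ₁, D₁, hD₁⟩ := exists_dilation (t := t / r) (by positivity)
      ((div_le_one hr).2 ht.le)
    refine ⟨1, α, δ ∘ δ₁, _, _, fun z => ?_, hD₁.comp (hU'.comp hE'), fun z => ?_⟩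
    · rw [Function.comp_apply, hδ, hδ₁]
      have : (r : ℂ) ≠ 0 := by exact_mod_cast hr.ne'
      push_cast
      field_simp
    · rw [hφ']
      simp only [Function.comp_apply, Homeomorph.apply_symm_apply]
  -- Tangent case, with `r = 1`: the upper factorization is trivial. For the lower one, `m ∘ δ` maps
  -- into the image disc, so `(m ∘ δ - p) / s` is a linear fractional self-map of the disc through
  -- which `m ∘ δ` factors.
  · obtain ⟨u, hu⟩ := exists_circle_mul_norm p
    refine tendsto_approxNumber_of_factorization hC one_pos le_rfl (fun t ht0 ht => ?_)
      ⟨1, 0, id, φ, C, fun z => by simp, hC, fun z => ?_⟩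
    · obtain ⟨x, hx0, hx1, hx⟩ := norm_moebius_sub_lt hu hp ht0 ht
      obtain ⟨δ, hδ, -⟩ := exists_dilation ht0.le ht.le
      have hxn : ‖(x : ℂ)‖ < 1 := by rwa [Complex.norm_real, Real.norm_of_nonneg hx0.le]
      set m := moebius u (Complex.UnitDisc.mk _ hxn) with hm
      have hcoe : ∀ z, (m (δ z) : ℂ) = u * (t * (z : ℂ) + x) / (1 + x * (t * (z : ℂ))) := fun z => by
        rw [hm, coe_moebius, hδ, Complex.UnitDisc.coe_mk, Complex.conj_ofReal]
      have hlt : ∀ z, ‖((m (δ z) : ℂ) - p) / s‖ < 1 := fun z => by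
        rw [norm_div, div_lt_one (norm_pos_iff.2 hs), eq_sub_of_add_eq' heq, hcoe]
        refine hx _ ?_
        rw [norm_mul, Complex.norm_real, Real.norm_of_nonneg ht0.le]
        exact mul_le_of_le_one_right ht0.le z.norm_lt_one.le
      have hu0 : (u : ℂ) ≠ 0 := u.coe_ne_zero
      have ht0' : (t : ℂ) ≠ 0 := by exact_mod_cast ht0.ne'
      have hx2 : 1 - (x : ℂ) ^ 2 ≠ 0 := by
        have : 1 - x ^ 2 ≠ 0 := by nlinarith
        exact_mod_cast this
      have hxt : x * t < 1 := by nlinarith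
      obtain ⟨S, hS⟩ := exists_compositionOperator_linearFractional
        (φ := fun z => Complex.UnitDisc.mk _ (hlt z)) (a := (u : ℂ) * t - p * x * t)
        (b := (u : ℂ) * x - p)
        (c := s * (x * t)) (d := s)
        (by
          have : ((u : ℂ) * t - p * x * t) * s - ((u : ℂ) * x - p) * (s * (x * t)) =
            s * u * t * (1 - (x : ℂ) ^ 2) := by ring
          rw [this]
          exact mul_ne_zero (mul_ne_zero (mul_ne_zero hs hu0) ht0') hx2)
        (by
          rw [norm_mul, norm_mul, Complex.norm_real, Complex.norm_real, Real.norm_of_nonneg hx0.le,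
            Real.norm_of_nonneg ht0.le]
          exact mul_lt_of_lt_one_right (norm_pos_iff.2 hs) hxt)
        fun z => by
          have hne : 1 + (x : ℂ) * (t * z) ≠ 0 := by
            have := one_add_conj_mul_ne_zero (Complex.UnitDisc.mk _ hxn) (δ z)
            rwa [hδ, Complex.UnitDisc.coe_mk, Complex.conj_ofReal] at this
          have hne2 : s * (x * t) * (z : ℂ) + s ≠ 0 := by
            have : s * (x * t) * (z : ℂ) + s = s * (1 + (x : ℂ) * (t * z)) := by ring
            rw [this]
            exact mul_ne_zero hs hne
          rw [Complex.UnitDisc.coe_mk, hcoe, div_sub' hne, div_div,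
            div_eq_div_iff (mul_ne_zero hne hs) hne2]
          ring
      refine ⟨u, Complex.UnitDisc.mk _ hxn, δ, _, _, hδ, hS.comp hE', fun z => ?_⟩
      apply Complex.UnitDisc.coe_injective
      rw [Function.comp_apply, hfac, Homeomorph.apply_symm_apply, Complex.UnitDisc.coe_mk, ← hm]
      field_simp
      ring
    · apply Complex.UnitDisc.coe_injective
      simp [coe_moebius]

/-! ### The coefficient criterion -/

/-- This is where the determinant enters the criterion: it makes `|q|²` strictly larger than `A D`.
-/
theorem normSq_sub_conj_mul_eq (a b c d : ℂ) :
    ‖conj a * b - conj c * d‖ ^ 2 =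
      (‖c‖ ^ 2 - ‖a‖ ^ 2) * (‖d‖ ^ 2 - ‖b‖ ^ 2) + ‖a * d - b * c‖ ^ 2 := by
  simp only [Complex.sq_norm, Complex.normSq_apply, Complex.sub_re, Complex.sub_im, Complex.mul_re,
    Complex.mul_im, Complex.conj_re, Complex.conj_im]
  ring

theorem normSq_sub_normSq_linear (a b c d z : ℂ) :
    ‖c * z + d‖ ^ 2 - ‖a * z + b‖ ^ 2 = (‖c‖ ^ 2 - ‖a‖ ^ 2) * ‖z‖ ^ 2 + (‖d‖ ^ 2 - ‖b‖ ^ 2) -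
      2 * (conj z * (conj a * b - conj c * d)).re := by
  simp only [Complex.sq_norm, Complex.normSq_apply, Complex.sub_re, Complex.sub_im, Complex.mul_re,
    Complex.mul_im, Complex.conj_re, Complex.conj_im, Complex.add_re, Complex.add_im]
  ring

theorem linearFractional_mapsTo_iff {a b c d : ℂ} (hdet : a * d - b * c ≠ 0) :
    (∀ z : 𝔻, c * (z : ℂ) + d ≠ 0 ∧ ‖(a * (z : ℂ) + b) / (c * (z : ℂ) + d)‖ < 1) ↔
      (‖a‖ ^ 2 + ‖b‖ ^ 2 + 2 * ‖conj a * b - conj c * d‖ ≤ ‖c‖ ^ 2 + ‖d‖ ^ 2 ∧ ‖c‖ ≤ ‖d‖) := by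
  set q := conj a * b - conj c * d with hq
  constructor
  · intro h
    refine ⟨?_, norm_le_norm_of_ne_zero fun z => (h z).1⟩
    -- The unit vector along `q` minimizes `|cz+d|² - |az+b|²` on the circle.
    obtain ⟨u, hu⟩ := exists_circle_mul_norm q
    have h1 := norm_le_of_linearFractional h (z := u) u.norm_coe.le
    have h2 := normSq_sub_normSq_linear a b c d u
    have h3 : conj (u : ℂ) * q = (‖q‖ : ℂ) := by
      nth_rewrite 1 [hu]
      rw [← mul_assoc, Complex.conj_mul', Circle.norm_coe]
      norm_num
    rw [← hq, h3, Complex.ofReal_re, Circle.norm_coe] at h2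
    have h4 : ‖a * u + b‖ ^ 2 ≤ ‖c * u + d‖ ^ 2 := by gcongr
    linarith
  · rintro ⟨h1, h2⟩ z
    have hdet' := norm_pos_iff.2 hdet
    have hid := normSq_sub_conj_mul_eq a b c d
    rw [← hq] at hid
    have hq0 := norm_nonneg q
    set A := ‖c‖ ^ 2 - ‖a‖ ^ 2 with hA
    set D := ‖d‖ ^ 2 - ‖b‖ ^ 2 with hD
    have hAD : 2 * ‖q‖ ≤ A + D := by linarith
    -- If `A = D`, then `|q|² = A² + |ad - bc|² > A²`, against `|q| ≤ A`.
    have hne : A ≠ D := by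
      intro h0
      rw [h0] at hid hAD
      nlinarith
    -- Bounding `|q|` below by `±(‖a‖‖b‖ - ‖c‖‖d‖)` gives `‖b‖ - ‖a‖ ≤ ‖d‖ - ‖c‖` and `‖a‖ + ‖b‖ ≤
    -- ‖d‖ + ‖c‖`; their product is `A ≤ D`. This step uses `‖c‖ ≤ ‖d‖`.
    have hle : A ≤ D := by
      by_contra! hlt
      have ha := norm_nonneg a
      have hb := norm_nonneg b
      have hc := norm_nonneg c
      have hd := norm_nonneg d
      have hprod : ‖a‖ * ‖b‖ - ‖c‖ * ‖d‖ ≤ ‖q‖ ∧ ‖c‖ * ‖d‖ - ‖a‖ * ‖b‖ ≤ ‖q‖ := by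
        have e1 : ‖conj a * b‖ = ‖a‖ * ‖b‖ := by rw [norm_mul, RCLike.norm_conj]
        have e2 : ‖conj c * d‖ = ‖c‖ * ‖d‖ := by rw [norm_mul, RCLike.norm_conj]
        have h5 := norm_sub_norm_le (conj a * b) (conj c * d)
        have h6 := norm_sub_norm_le (conj c * d) (conj a * b)
        rw [norm_sub_rev] at h6
        rw [e1, e2] at h5 h6
        exact ⟨h5, h6⟩
      have h5 : (‖a‖ - ‖b‖) ^ 2 ≤ (‖d‖ - ‖c‖) ^ 2 := by nlinarith [hprod.2]
      have h6 : (‖a‖ + ‖b‖) ^ 2 ≤ (‖d‖ + ‖c‖) ^ 2 := by nlinarith [hprod.1]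
      have h7 : ‖b‖ - ‖a‖ ≤ ‖d‖ - ‖c‖ := by
        have := abs_le_of_sq_le_sq' h5 (by linarith)
        linarith [this.1]
      have h8 : ‖a‖ + ‖b‖ ≤ ‖d‖ + ‖c‖ := (abs_le_of_sq_le_sq' h6 (by linarith)).2
      have h9 : (‖b‖ - ‖a‖) * (‖a‖ + ‖b‖) ≤ (‖d‖ - ‖c‖) * (‖d‖ + ‖c‖) :=
        mul_le_mul h7 h8 (by linarith) (by linarith)
      nlinarith
    have hlt : A < D := lt_of_le_of_ne hle hne
    have hz := z.norm_lt_one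
    have hz0 := norm_nonneg (z : ℂ)
    have hden : c * (z : ℂ) + d ≠ 0 := by
      intro h0
      have h3 : ‖d‖ = ‖c‖ * ‖(z : ℂ)‖ := by
        rw [eq_neg_of_add_eq_zero_right h0, norm_neg, norm_mul]
      have hc0 : ‖c‖ = 0 := by nlinarith [norm_nonneg c]
      rw [hc0, zero_mul] at h3
      rw [norm_eq_zero] at hc0 h3
      simp [hc0, h3] at hdet
    refine ⟨hden, ?_⟩
    rw [norm_div, div_lt_one (norm_pos_iff.2 hden)]
    refine (sq_lt_sq₀ (norm_nonneg _) (norm_nonneg _)).1 ?_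
    have h4 := normSq_sub_normSq_linear a b c d z
    have h5 : (conj (z : ℂ) * q).re ≤ ‖(z : ℂ)‖ * ‖q‖ := by
      refine (Complex.re_le_norm _).trans ?_
      rw [norm_mul, RCLike.norm_conj]
    rw [← hq, ← hA, ← hD] at h4
    set ρ := ‖(z : ℂ)‖
    -- For `A ≥ 0` this follows from `A < D`; for `A < 0`, from `D ≥ -A > 0`.
    have h6 : 0 < D - A * ρ := by
      rcases le_or_gt 0 A with hA0 | hA0
      · nlinarith
      · nlinarith
    have h7 : 0 < (1 - ρ) * (D - A * ρ) := mul_pos (by linarith) h6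
    have h8 : ρ * (2 * ‖q‖) ≤ ρ * (A + D) := mul_le_mul_of_nonneg_left hAD hz0
    nlinarith

theorem mainTheorem7 (a b c d : ℂ) :
    (a * d - b * c ≠ 0 →
      ((∀ z : 𝔻, c * (z : ℂ) + d ≠ 0 ∧ ‖(a * (z : ℂ) + b) / (c * (z : ℂ) + d)‖ < 1) ↔
        (‖a‖ ^ 2 + ‖b‖ ^ 2 + 2 * ‖conj a * b - conj c * d‖ ≤ ‖c‖ ^ 2 + ‖d‖ ^ 2 ∧ ‖c‖ ≤ ‖d‖))) ∧
    ∀ φ : 𝔻 → 𝔻,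
      (∀ z : 𝔻, c * (z : ℂ) + d ≠ 0 ∧
        (φ z : ℂ) = (a * (z : ℂ) + b) / (c * (z : ℂ) + d)) →
      ∃ C : HardySpace →L[ℂ] HardySpace, IsCompositionOperator φ C ∧
        Filter.Tendsto (fun n : ℕ => approxNumber C n ^ (1 / (n : ℝ))) Filter.atTop
          (𝓝 (expNegInv (greenCapacity (closure (Set.range φ))))) := by
  refine ⟨linearFractional_mapsTo_iff, fun φ hφ => ?_⟩
  rcases eq_or_ne (a * d - b * c) 0 with hdet | hdet
  · have hd : d ≠ 0 := by simpa using (hφ 0).1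
    have hconst : ∀ z, φ z = φ 0 := fun z => by
      apply Complex.UnitDisc.coe_injective
      rw [(hφ z).2, (hφ 0).2, div_eq_div_iff (hφ z).1 (hφ 0).1, Complex.UnitDisc.coe_zero]
      linear_combination (z : ℂ) * hdet
    obtain ⟨C, hC⟩ := exists_compositionOperator_affine (φ := φ) (p := φ 0) (s := 0)
      (φ 0).norm_lt_one (by simpa using (φ 0).norm_lt_one.le) fun z => by rw [hconst z]; simp
    exact ⟨C, hC, tendsto_approxNumber_of_const hC hconst⟩
  · have hlt : ‖c‖ < ‖d‖ := norm_lt_norm_of_linearFractional hdet fun z =>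
      ⟨(hφ z).1, by rw [← (hφ z).2]; exact (φ z).norm_lt_one⟩
    obtain ⟨C, hC⟩ := exists_compositionOperator_linearFractional hdet hlt fun z => (hφ z).2
    exact ⟨C, hC, tendsto_approxNumber_linearFractional hdet hlt (fun z => (hφ z).2) hC⟩
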